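/- Let $H,K$ be complex Hilbert spaces. A TRO is a norm closed linear subspace $T\subseteq B(H,K)$ with $rs^*t\in T$ for all $r,s,t\in T$; write $\langle S\rangle$ for the norm closed linear span of a set $S$, and let \[ A_T=\begin{pmatrix}\langle TT^*\rangle & T\\ T^* & \langle T^*T\rangle\end{pmatrix}\subseteq B(K\oplus H) \] be the linking algebra of $T$. For C*-algebras $B\subseteq A$, a conditional expectation from $A$ onto $B$ is a contractive positive linear map $E\colon A\to B$ such that $E(b)=b$, $E(ba)=bE(a)$ and $E(ab)=E(a)b$ for all $a\in A$, $b\in B$. **Theorem 2.1.** Let $T\subseteq B(H,K)$ be a TRO and let $X\subseteq T$ be a sub-TRO (that is, $X$ is itself a TRO) which is nondegenerate in $T$, meaning $\langle XT^*T\rangle=T$ and $\langle TT^*X\rangle=T$. Let $P\colon T\to X$ be a contractive idempotent linear map onto $X$, and put $P^\dagger(s^*)=P(s)^*$ for $s\in T$. Then there are linear maps $PP^\dagger\colon\langle TT^*\rangle\to\langle XX^*\rangle$ and $P^\dagger P\colon\langle T^*T\rangle\to\langle X^*X\rangle$ satisfying \[ PP^\dagger\Bigl(\sum_{i=1}^n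 a_ix_i^*\Bigr)=\sum_{i=1}^n P(a_i)x_i^*,\qquad P^\dagger P\Bigl(\sum_{i=1}^n x_i^*a_i\Bigr)=\sum_{i=1}^n x_i^*P(a_i) \] for all $n\in\mathbb N$, $a_1,\dots,a_n\in T$, $x_1,\dots,x_n\in X$, such that \[ E=\begin{pmatrix}PP^\dagger & P\\ P^\dagger & P^\dagger P\end{pmatrix}\colon A_T\to A_X,\qquad \begin{pmatrix}c&t\\ s^*&d\end{pmatrix}\mapsto\begin{pmatrix}PP^\dagger(c)&P(t)\\ P(s)^*&P^\dagger P(d)\end{pmatrix}, \] is a conditional expectation from $A_T$ onto $A_X$. Moreover $E$ is unique: if $E'$ is a conditional expectation from $A_T$ onto $A_X$ such that, for every $t\in T$, the $(1,2)$ entry of $E'\begin{pmatrix}0&t\\0&0\end{pmatrix}$ is $P(t)$, then $E'=E$. -/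

import Mathlib

open scoped InnerProduct

noncomputable section

/-- The norm closed linear span of a subset of a normed space. -/
def closedSpan {F : Type*} [NormedAddCommGroup F] [NormedSpace ℂ F] (S : Set F) :
    Submodule ℂ F :=
  (Submodule.span ℂ S).topologicalClosure

theorem subset_closedSpan {F : Type*} [NormedAddCommGroup F] [NormedSpace ℂ F] {S : Set F}
    {x : F} (hx : x ∈ S) : x ∈ closedSpan S :=
  Submodule.le_topologicalClosure _ (Submodule.subset_span hx)

theorem closedSpan_mono {F : Type*} [NormedAddCommGroup F] [NormedSpace ℂ F] {S S' : Set F}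
    (h : S ⊆ S') : closedSpan S ≤ closedSpan S' :=
  Submodule.topologicalClosure_mono (Submodule.span_mono h)

theorem map_closedSpan {σ : ℂ →+* ℂ} {F G : Type*} [NormedAddCommGroup F] [NormedSpace ℂ F]
    [NormedAddCommGroup G] [NormedSpace ℂ G] {S : Set F} (N : Submodule ℂ G)
    (hN : IsClosed (N : Set G)) (f : F →SL[σ] G) (h : ∀ x ∈ S, f x ∈ N) :
    ∀ x ∈ closedSpan S, f x ∈ N := by
  have key : closedSpan S ≤ N.comap f.toLinearMap := by
    refine Submodule.topologicalClosure_minimal _ (Submodule.span_le.2 h) ?_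
    exact hN.preimage f.continuous
  exact fun x hx => key hx

theorem isClosed_closedSpan {F : Type*} [NormedAddCommGroup F] [NormedSpace ℂ F] (S : Set F) :
    IsClosed (closedSpan S : Set F) :=
  Submodule.isClosed_topologicalClosure _

section Block

variable {H K : Type*} [NormedAddCommGroup H] [InnerProductSpace ℂ H]
  [NormedAddCommGroup K] [InnerProductSpace ℂ K]

/-- The operator `(a b; c d)` on the Hilbert space direct sum `K ⊕ H`. -/
def blockOp (a : K →L[ℂ] K) (b : H →L[ℂ] K) (c : K →L[ℂ] H) (d : H →L[ℂ] H) :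
    WithLp 2 (K × H) →L[ℂ] WithLp 2 (K × H) :=
  (WithLp.prodContinuousLinearEquiv 2 ℂ K H).symm.toContinuousLinearMap ∘L
    ((a.coprod b).prod (c.coprod d)) ∘L
    (WithLp.prodContinuousLinearEquiv 2 ℂ K H).toContinuousLinearMap

/-- The `(1,2)` entry, an operator `H → K`, of an operator on `K ⊕ H`. -/
def entry₁₂ (m : WithLp 2 (K × H) →L[ℂ] WithLp 2 (K × H)) : H →L[ℂ] K :=
  ContinuousLinearMap.fst ℂ K H ∘L
    (WithLp.prodContinuousLinearEquiv 2 ℂ K H).toContinuousLinearMap ∘L m ∘L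
    (WithLp.prodContinuousLinearEquiv 2 ℂ K H).symm.toContinuousLinearMap ∘L
    ContinuousLinearMap.inr ℂ K H

@[simp] theorem blockOp_apply (a : K →L[ℂ] K) (b : H →L[ℂ] K) (c : K →L[ℂ] H) (d : H →L[ℂ] H)
    (v : WithLp 2 (K × H)) :
    blockOp a b c d v = WithLp.toLp 2 (a v.fst + b v.snd, c v.fst + d v.snd) := rfl

theorem entry₁₂_blockOp (a : K →L[ℂ] K) (b : H →L[ℂ] K) (c : K →L[ℂ] H) (d : H →L[ℂ] H) :
    entry₁₂ (blockOp a b c d) = b := by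
  ext v
  simp [entry₁₂]

theorem blockOp_mul (a a' : K →L[ℂ] K) (b b' : H →L[ℂ] K) (c c' : K →L[ℂ] H)
    (d d' : H →L[ℂ] H) :
    blockOp a b c d * blockOp a' b' c' d' =
      blockOp (a ∘L a' + b ∘L c') (a ∘L b' + b ∘L d') (c ∘L a' + d ∘L c')
        (c ∘L b' + d ∘L d') := by
  refine ContinuousLinearMap.ext fun v => WithLp.ofLp_injective 2 (Prod.ext ?_ ?_) <;>
    simp <;> abel

end Block

section TRO

variable {H K : Type*} [NormedAddCommGroup H] [InnerProductSpace ℂ H] [CompleteSpace H]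
  [NormedAddCommGroup K] [InnerProductSpace ℂ K] [CompleteSpace K]

/-- A ternary ring of operators: a norm closed subspace `T` of `B(H, K)` with `T T* T ⊆ T`. -/
structure IsTRO (T : Submodule ℂ (H →L[ℂ] K)) : Prop where
  isClosed : IsClosed (T : Set (H →L[ℂ] K))
  triple_mem : ∀ r ∈ T, ∀ s ∈ T, ∀ t ∈ T, r ∘L s† ∘L t ∈ T

/-- `⟨T T*⟩`, a subspace of `B(K)`. -/
def leftAlg (T : Submodule ℂ (H →L[ℂ] K)) : Submodule ℂ (K →L[ℂ] K) :=
  closedSpan {c | ∃ t ∈ T, ∃ s ∈ T, c = t ∘L s†}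

/-- `⟨T* T⟩`, a subspace of `B(H)`. -/
def rightAlg (T : Submodule ℂ (H →L[ℂ] K)) : Submodule ℂ (H →L[ℂ] H) :=
  closedSpan {d | ∃ t ∈ T, ∃ s ∈ T, d = t† ∘L s}

/-- Nondegeneracy of `X` in `T`, in the norm sense: `⟨X T* T⟩ = T` and `⟨T T* X⟩ = T`. -/
structure IsNondegenerateIn (X T : Submodule ℂ (H →L[ℂ] K)) : Prop where
  left : closedSpan {r | ∃ x ∈ X, ∃ s ∈ T, ∃ t ∈ T, r = x ∘L s† ∘L t} = T
  right : closedSpan {r | ∃ s ∈ T, ∃ t ∈ T, ∃ x ∈ X, r = s ∘L t† ∘L x} = T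

theorem comp_adjoint_mem_leftAlg {T : Submodule ℂ (H →L[ℂ] K)} {t s : H →L[ℂ] K}
    (ht : t ∈ T) (hs : s ∈ T) : t ∘L s† ∈ leftAlg T :=
  subset_closedSpan ⟨t, ht, s, hs, rfl⟩

theorem adjoint_comp_mem_rightAlg {T : Submodule ℂ (H →L[ℂ] K)} {t s : H →L[ℂ] K}
    (ht : t ∈ T) (hs : s ∈ T) : t† ∘L s ∈ rightAlg T :=
  subset_closedSpan ⟨t, ht, s, hs, rfl⟩

theorem adjoint_mem_leftAlg {T : Submodule ℂ (H →L[ℂ] K)} {c : K →L[ℂ] K}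
    (hc : c ∈ leftAlg T) : c† ∈ leftAlg T := by
  refine map_closedSpan (leftAlg T) (isClosed_closedSpan _)
    (ContinuousLinearMap.adjoint (𝕜 := ℂ) (E := K) (F := K)
      |>.toContinuousLinearEquiv.toContinuousLinearMap) ?_ c hc
  rintro _ ⟨t, ht, s, hs, rfl⟩
  exact subset_closedSpan ⟨s, hs, t, ht, by
    simp [ContinuousLinearMap.adjoint_comp]⟩

theorem adjoint_mem_rightAlg {T : Submodule ℂ (H →L[ℂ] K)} {d : H →L[ℂ] H}
    (hd : d ∈ rightAlg T) : d† ∈ rightAlg T := by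
  refine map_closedSpan (rightAlg T) (isClosed_closedSpan _)
    (ContinuousLinearMap.adjoint (𝕜 := ℂ) (E := H) (F := H)
      |>.toContinuousLinearEquiv.toContinuousLinearMap) ?_ d hd
  rintro _ ⟨t, ht, s, hs, rfl⟩
  exact subset_closedSpan ⟨s, hs, t, ht, by
    simp [ContinuousLinearMap.adjoint_comp]⟩

theorem IsTRO.leftAlg_comp {T : Submodule ℂ (H →L[ℂ] K)} (hT : IsTRO T) {c : K →L[ℂ] K}
    (hc : c ∈ leftAlg T) {t : H →L[ℂ] K} (ht : t ∈ T) : c ∘L t ∈ T := by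
  refine map_closedSpan T hT.isClosed ((ContinuousLinearMap.compL ℂ H K K).flip t) ?_ c hc
  rintro _ ⟨r, hr, s, hs, rfl⟩
  exact hT.triple_mem r hr s hs t ht

theorem IsTRO.comp_rightAlg {T : Submodule ℂ (H →L[ℂ] K)} (hT : IsTRO T) {d : H →L[ℂ] H}
    (hd : d ∈ rightAlg T) {t : H →L[ℂ] K} (ht : t ∈ T) : t ∘L d ∈ T := by
  refine map_closedSpan T hT.isClosed (ContinuousLinearMap.compL ℂ H H K t) ?_ d hd
  rintro _ ⟨r, hr, s, hs, rfl⟩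
  exact hT.triple_mem t ht r hr s hs

theorem IsTRO.leftAlg_mul {T : Submodule ℂ (H →L[ℂ] K)} (hT : IsTRO T) {c c' : K →L[ℂ] K}
    (hc : c ∈ leftAlg T) (hc' : c' ∈ leftAlg T) : c ∘L c' ∈ leftAlg T := by
  refine map_closedSpan (leftAlg T) (isClosed_closedSpan _)
    (ContinuousLinearMap.compL ℂ K K K c) ?_ c' hc'
  rintro _ ⟨r, hr, s, hs, rfl⟩
  exact comp_adjoint_mem_leftAlg (hT.leftAlg_comp hc hr) hs

theorem IsTRO.rightAlg_mul {T : Submodule ℂ (H →L[ℂ] K)} (hT : IsTRO T) {d d' : H →L[ℂ] H}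
    (hd : d ∈ rightAlg T) (hd' : d' ∈ rightAlg T) : d ∘L d' ∈ rightAlg T := by
  refine map_closedSpan (rightAlg T) (isClosed_closedSpan _)
    ((ContinuousLinearMap.compL ℂ H H H).flip d') ?_ d hd
  rintro _ ⟨r, hr, s, hs, rfl⟩
  have h : r† ∘L (s ∘L d') ∈ rightAlg T :=
    adjoint_comp_mem_rightAlg hr (hT.comp_rightAlg hd' hs)
  rw [ContinuousLinearMap.flip_apply, ContinuousLinearMap.compL_apply,
    ContinuousLinearMap.comp_assoc]
  exact h

theorem star_blockOp (a : K →L[ℂ] K) (b : H →L[ℂ] K) (c : K →L[ℂ] H) (d : H →L[ℂ] H) :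
    star (blockOp a b c d) = blockOp (a†) (c†) (b†) (d†) := by
  rw [ContinuousLinearMap.star_eq_adjoint, eq_comm, ContinuousLinearMap.eq_adjoint_iff]
  intro v w
  simp [WithLp.prod_inner_apply, inner_add_left, inner_add_right,
    ContinuousLinearMap.adjoint_inner_left]
  ring

/-- The linking algebra `A_T = (⟨T T*⟩ T; T* ⟨T* T⟩)`, acting on `K ⊕ H`. -/
def linkingAlgebra (T : Submodule ℂ (H →L[ℂ] K)) (hT : IsTRO T) :
    NonUnitalStarSubalgebra ℂ (WithLp 2 (K × H) →L[ℂ] WithLp 2 (K × H)) where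
  carrier := {m | ∃ c ∈ leftAlg T, ∃ t ∈ T, ∃ s ∈ T, ∃ d ∈ rightAlg T, m = blockOp c t (s†) d}
  zero_mem' := ⟨0, zero_mem _, 0, zero_mem _, 0, zero_mem _, 0, zero_mem _, by
    refine ContinuousLinearMap.ext fun v => WithLp.ofLp_injective 2 (Prod.ext ?_ ?_) <;>
      simp⟩
  add_mem' := by
    rintro _ _ ⟨c, hc, t, ht, s, hs, d, hd, rfl⟩ ⟨c', hc', t', ht', s', hs', d', hd', rfl⟩
    refine ⟨c + c', add_mem hc hc', t + t', add_mem ht ht', s + s', add_mem hs hs', d + d',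
      add_mem hd hd', ?_⟩
    refine ContinuousLinearMap.ext fun v => WithLp.ofLp_injective 2 (Prod.ext ?_ ?_) <;>
      simp <;> abel
  smul_mem' := by
    rintro z _ ⟨c, hc, t, ht, s, hs, d, hd, rfl⟩
    refine ⟨z • c, Submodule.smul_mem _ _ hc, z • t, Submodule.smul_mem _ _ ht,
      (starRingEnd ℂ z) • s, Submodule.smul_mem _ _ hs, z • d, Submodule.smul_mem _ _ hd, ?_⟩
    refine ContinuousLinearMap.ext fun v => WithLp.ofLp_injective 2 (Prod.ext ?_ ?_) <;>
      simp [map_smulₛₗ]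
  mul_mem' := by
    rintro _ _ ⟨c, hc, t, ht, s, hs, d, hd, rfl⟩ ⟨c', hc', t', ht', s', hs', d', hd', rfl⟩
    refine ⟨c ∘L c' + t ∘L s'†,
      add_mem (hT.leftAlg_mul hc hc') (comp_adjoint_mem_leftAlg ht hs'),
      c ∘L t' + t ∘L d', add_mem (hT.leftAlg_comp hc ht') (hT.comp_rightAlg hd' ht),
      c'† ∘L s + s' ∘L d†,
      add_mem (hT.leftAlg_comp (adjoint_mem_leftAlg hc') hs)
        (hT.comp_rightAlg (adjoint_mem_rightAlg hd) hs'),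
      s† ∘L t' + d ∘L d',
      add_mem (adjoint_comp_mem_rightAlg hs ht') (hT.rightAlg_mul hd hd'), ?_⟩
    rw [blockOp_mul]
    simp [ContinuousLinearMap.adjoint_comp]
  star_mem' := by
    rintro _ ⟨c, hc, t, ht, s, hs, d, hd, rfl⟩
    refine ⟨c†, adjoint_mem_leftAlg hc, s, hs, t, ht, d†, adjoint_mem_rightAlg hd, ?_⟩
    rw [star_blockOp, ContinuousLinearMap.adjoint_adjoint]

/-- The element `(c t; s* d)` of the linking algebra. -/
def linkingAlgebra.mk {T : Submodule ℂ (H →L[ℂ] K)} (hT : IsTRO T) (c : leftAlg T) (t s : T)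
    (d : rightAlg T) : linkingAlgebra T hT :=
  ⟨blockOp (c : K →L[ℂ] K) (t : H →L[ℂ] K) ((s : H →L[ℂ] K)†) (d : H →L[ℂ] H),
    c, c.2, t, t.2, s, s.2, d, d.2, rfl⟩

theorem linkingAlgebra_mono {X T : Submodule ℂ (H →L[ℂ] K)} (hX : IsTRO X) (hT : IsTRO T)
    (h : X ≤ T) : linkingAlgebra X hX ≤ linkingAlgebra T hT := by
  rintro _ ⟨c, hc, t, ht, s, hs, d, hd, rfl⟩
  refine ⟨c, closedSpan_mono ?_ hc, t, h ht, s, h hs, d, closedSpan_mono ?_ hd, rfl⟩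
  · rintro _ ⟨t, ht, s, hs, rfl⟩
    exact ⟨t, h ht, s, h hs, rfl⟩
  · rintro _ ⟨t, ht, s, hs, rfl⟩
    exact ⟨t, h ht, s, h hs, rfl⟩

end TRO

/-- `E : A → B` is a conditional expectation of the operator algebra `A` onto its subalgebra `B`:
a contractive, positive linear idempotent onto `B` which is a `B`-bimodule map (such a map is
automatically completely positive). Norms and positivity are those of bounded operators. -/
structure IsConditionalExpectation {L : Type*} [NormedAddCommGroup L] [InnerProductSpace ℂ L]
    [CompleteSpace L] {A B : NonUnitalStarSubalgebra ℂ (L →L[ℂ] L)} (hBA : B ≤ A)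
    (E : A →ₗ[ℂ] B) : Prop where
  contractive : ∀ a : A, ‖(E a : L →L[ℂ] L)‖ ≤ ‖(a : L →L[ℂ] L)‖
  apply_of_mem : ∀ b : B, E (NonUnitalStarSubalgebra.inclusion hBA b) = b
  positive : ∀ a : A, (a : L →L[ℂ] L).IsPositive → (E a : L →L[ℂ] L).IsPositive
  mul_left : ∀ (b : B) (a : A), E (NonUnitalStarSubalgebra.inclusion hBA b * a) = b * E a
  mul_right : ∀ (a : A) (b : B), E (a * NonUnitalStarSubalgebra.inclusion hBA b) = E a * b

end

/-!
The theorem rests on four facts.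

*A contractive projection `P` of `T` onto `X` is an `⟨X X*⟩`-`⟨X* X⟩`-bimodule map.* For spectral
projections `e` of the multipliers this would be Tomiyama's argument: for `b = (1 - e) t` and `r`
large, comparing `b + r e P(b)` with its image `P(b) + r e P(b)` forces `e P(b) = 0`. As `⟨X X*⟩`
need not contain projections, it is run for continuous functions `f(c)`, `g(c)` of a self-adjoint `c`
with `f g = 0` (`IsContrProj.cfc_comp_apply_eq_zero`). To pass from disjoint supports to `c` itself,
take `a` in the kernel of `P` and cover the spectrum of `c` by `O(1/δ)` tent functions `φ` of width
`δ`. Each `φ(c) P(c a)` has norm `O(δ)`, because near the centre `τ` one may replace `c` by `c - τ`.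
The sum of the squares is `O(δ)`, so `P(c a) = 0` (`IsContrProj.apply_comp_eq_zero`). The right-handed
statement is the left-handed one for the adjoint TRO `T*`.

*`⟨X X*⟩` acts isometrically on `X`* (`IsTRO.norm_leftAlg_le`). Hence the relation `b y = P(c y)` for
all `y ∈ X`, between `c ∈ ⟨T T*⟩` and `b ∈ ⟨X X*⟩`, is a contractive partial map. By the module
property it is defined on the elements `a x*`, which span a dense subspace by nondegeneracy, so it is
defined everywhere: this is `PP†`. The map `P†P` is the same construction for `T*`.

*A contractive bimodule projection onto a closed star subalgebra is positive*
(`IsCompressionDominated.isPositive`): it can only shrink the discs that contain the numerical range,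
once operators are compressed by an approximate unit of the subalgebra. This makes `PP†` and `P†P`
adjoint preserving, which gives `PP†(x s*) = x P(s)*` and thus the bimodule property of the matrix
map `E`.

*`E` is contractive.* On a single column `v` the operator `v* v` lies in a corner, where `E` is
positive and contractive, so `E(v)* E(v) ≤ E(v* v)` bounds `E(v)`. For general `m` and a column `y`
of `A_X` one has `E(m) y = E(m y)`, and `A_X` acts isometrically on its columns. Positivity of `E`
then follows as for the corners.

Uniqueness is algebra: multiplying by the corners of `A_X` shows that a conditional expectation
respects the four corners of `A_T`, and multiplying by `X` determines it on each of them from its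
values on `T`.
-/

noncomputable section

set_option linter.unusedSectionVars false

/-! ### Multipliers and locality of contractive projections -/

section Multipliers

variable {H K : Type*} [NormedAddCommGroup H] [InnerProductSpace ℂ H] [CompleteSpace H]
  [NormedAddCommGroup K] [InnerProductSpace ℂ K] [CompleteSpace K]

/-- The star algebra of all `m ∈ B(K)` such that both `m` and `m*` map the subspace `V` of
`B(H, K)` into itself by left multiplication. -/
def leftMultiplier (V : Submodule ℂ (H →L[ℂ] K)) : StarSubalgebra ℂ (K →L[ℂ] K) where
  carrier := {m | ∀ v ∈ V, m ∘L v ∈ V ∧ m† ∘L v ∈ V}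
  mul_mem' := by
    intro a b ha hb v hv
    refine ⟨(ha _ (hb v hv).1).1, ?_⟩
    have h := (hb _ (ha v hv).2).2
    rwa [← ContinuousLinearMap.comp_assoc, ← ContinuousLinearMap.adjoint_comp] at h
  add_mem' := by
    intro a b ha hb v hv
    rw [map_add, ContinuousLinearMap.add_comp, ContinuousLinearMap.add_comp]
    exact ⟨add_mem (ha v hv).1 (hb v hv).1, add_mem (ha v hv).2 (hb v hv).2⟩
  algebraMap_mem' := by
    intro r v hv
    rw [Algebra.algebraMap_eq_smul_one, map_smulₛₗ, ContinuousLinearMap.smul_comp,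
      ContinuousLinearMap.smul_comp, ContinuousLinearMap.one_def, ContinuousLinearMap.adjoint_id]
    exact ⟨V.smul_mem _ hv, V.smul_mem _ hv⟩
  star_mem' := by
    intro a ha v hv
    rw [ContinuousLinearMap.star_eq_adjoint, ContinuousLinearMap.adjoint_adjoint]
    exact (ha v hv).symm

theorem isClosed_leftMultiplier {V : Submodule ℂ (H →L[ℂ] K)}
    (hV : IsClosed (V : Set (H →L[ℂ] K))) :
    IsClosed (leftMultiplier V : Set (K →L[ℂ] K)) := by
  have h : (leftMultiplier V : Set (K →L[ℂ] K)) =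
      ⋂ v ∈ V, {m : K →L[ℂ] K | m ∘L v ∈ V} ∩ {m : K →L[ℂ] K | m† ∘L v ∈ V} := by
    ext m
    simp only [Set.mem_iInter]
    rfl
  rw [h]
  refine isClosed_biInter fun v _ => IsClosed.inter ?_ ?_
  · exact hV.preimage ((ContinuousLinearMap.compL ℂ H K K).flip v).continuous
  · exact hV.preimage (((ContinuousLinearMap.compL ℂ H K K).flip v).continuous.comp
      (ContinuousLinearMap.adjoint (𝕜 := ℂ) (E := K) (F := K)).continuous)

theorem cfc_comp_mem {V : Submodule ℂ (H →L[ℂ] K)} (hV : IsClosed (V : Set (H →L[ℂ] K)))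
    {c : K →L[ℂ] K} (hc : c ∈ leftMultiplier V) (f : ℝ → ℝ) {v : H →L[ℂ] K} (hv : v ∈ V) :
    cfc f c ∘L v ∈ V := by
  have := isClosed_leftMultiplier hV
  exact (cfc_mem (s := leftMultiplier V) f hc v hv).1

theorem norm_add_sq_le_of_adjoint_comp_eq_zero {a b : H →L[ℂ] K} (h : a† ∘L b = 0) :
    ‖a + b‖ ^ 2 ≤ ‖a‖ ^ 2 + ‖b‖ ^ 2 := by
  have key : ‖a + b‖ ≤ √(‖a‖ ^ 2 + ‖b‖ ^ 2) := by
    refine ContinuousLinearMap.opNorm_le_bound _ (Real.sqrt_nonneg _) fun v => ?_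
    have h0 : inner ℂ (a v) (b v) = 0 := by
      rw [← ContinuousLinearMap.adjoint_inner_right]
      have : (a†) (b v) = 0 := congrArg (fun f : H →L[ℂ] H => f v) h
      rw [this, inner_zero_right]
    have h1 := norm_add_sq_eq_norm_sq_add_norm_sq_of_inner_eq_zero (a v) (b v) h0
    have ha := a.le_opNorm v
    have hb := b.le_opNorm v
    rw [add_apply]
    refine Real.le_sqrt_of_sq_le ?_ |>.trans_eq ?_ (b := √((‖a‖ ^ 2 + ‖b‖ ^ 2) * ‖v‖ ^ 2))
    · have ha2 := mul_self_le_mul_self (norm_nonneg _) ha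
      have hb2 := mul_self_le_mul_self (norm_nonneg _) hb
      nlinarith
    · rw [Real.sqrt_mul (by positivity), Real.sqrt_sq (norm_nonneg _)]
  calc ‖a + b‖ ^ 2 ≤ √(‖a‖ ^ 2 + ‖b‖ ^ 2) ^ 2 := by gcongr
    _ = _ := Real.sq_sqrt (by positivity)

/-- A linear map `p` on `B(H, K)` restricting to a contractive projection of `T` onto `X`. What
`p` does outside `T` plays no role; working with it on all of `B(H, K)` avoids subtypes. -/
structure IsContrProj (T X : Submodule ℂ (H →L[ℂ] K))
    (p : (H →L[ℂ] K) →ₗ[ℂ] (H →L[ℂ] K)) : Prop where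
  le : X ≤ T
  mem : ∀ t ∈ T, p t ∈ X
  fix : ∀ x ∈ X, p x = x
  norm_le : ∀ t ∈ T, ‖p t‖ ≤ ‖t‖

/-- A truncation `min 1 (n h)` acts as a near-identity on `h`. -/
theorem abs_sub_mul_min_le {h : ℝ} (h0 : 0 ≤ h) {n : ℝ} (hn : 0 < n) :
    |h - h * min 1 (n * h)| ≤ 1 / n := by
  rcases le_total 1 (n * h) with h2 | h2
  · rw [min_eq_left h2]
    simp only [mul_one, sub_self, abs_zero]
    positivity
  · rw [min_eq_right h2, abs_of_nonneg (by nlinarith), le_div_iff₀ hn]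
    nlinarith [mul_nonneg h0 (mul_nonneg hn.le h0), mul_nonneg hn.le h0]

theorem eq_zero_of_forall_one_add_sq_mul_le {S B : ℝ}
    (h : ∀ r : ℝ, 0 ≤ r → (1 + r) ^ 2 * S ^ 2 ≤ B ^ 2 + r ^ 2 * S ^ 2) : S = 0 := by
  by_contra hS
  have hS2 : 0 < S ^ 2 := by positivity
  have := h (B ^ 2 / S ^ 2) (by positivity)
  have h3 : B ^ 2 / S ^ 2 * S ^ 2 = B ^ 2 := div_mul_cancel₀ _ hS2.ne'
  nlinarith [sq_nonneg B]

/-- Tomiyama's argument, with functions of `c` in place of spectral projections: a contractive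
projection is local with respect to left multiplication by disjointly supported functions of a
multiplier `c`. With `b = g(c) t` and `z = p b`, compare the norms of `b + r k(c) z` and of its image
`z + r k(c) z` for large `r`, where `k` vanishes on the support of `g`: by Pythagoras the former is
too small unless the supremum of `‖h(c) z‖` over all such `h` is zero. -/
theorem IsContrProj.cfc_comp_apply_eq_zero {T X : Submodule ℂ (H →L[ℂ] K)}
    {p : (H →L[ℂ] K) →ₗ[ℂ] (H →L[ℂ] K)} (hp : IsContrProj T X p)
    (hT : IsClosed (T : Set (H →L[ℂ] K))) (hX : IsClosed (X : Set (H →L[ℂ] K)))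
    {c : K →L[ℂ] K} (hcT : c ∈ leftMultiplier T) (hcX : c ∈ leftMultiplier X)
    {f g : ℝ → ℝ} (hf : Continuous f) (hg : Continuous g) (hf0 : ∀ s, 0 ≤ f s)
    (hf1 : ∀ s, f s ≤ 1) (hfg : ∀ s, f s * g s = 0) {t : H →L[ℂ] K} (ht : t ∈ T) :
    cfc f c ∘L p (cfc g c ∘L t) = 0 := by
  set b : H →L[ℂ] K := cfc g c ∘L t with hb
  have hbT : b ∈ T := cfc_comp_mem hT hcT g ht
  set z := p b with hz
  have hzX : z ∈ X := hp.mem b hbT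
  let F : Set (ℝ → ℝ) :=
    {h | Continuous h ∧ (∀ s, 0 ≤ h s) ∧ (∀ s, h s ≤ 1) ∧ ∀ s, h s * g s = 0}
  have hnorm : ∀ h ∈ F, ‖cfc h c‖ ≤ 1 := fun h hh =>
    norm_cfc_le zero_le_one fun s _ => by
      rw [Real.norm_eq_abs, abs_of_nonneg (hh.2.1 s)]
      exact hh.2.2.1 s
  let S : ℝ := ⨆ h : F, ‖cfc (h : ℝ → ℝ) c ∘L z‖
  have hbdd : BddAbove (Set.range fun h : F => ‖cfc (h : ℝ → ℝ) c ∘L z‖) := by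
    refine ⟨‖z‖, ?_⟩
    rintro _ ⟨h, rfl⟩
    calc ‖cfc (h : ℝ → ℝ) c ∘L z‖ ≤ ‖cfc (h : ℝ → ℝ) c‖ * ‖z‖ :=
          ContinuousLinearMap.opNorm_comp_le _ _
      _ ≤ 1 * ‖z‖ := by gcongr; exact hnorm h h.2
      _ = ‖z‖ := one_mul _
  have hle : ∀ h ∈ F, ‖cfc h c ∘L z‖ ≤ S := fun h hh => le_ciSup hbdd ⟨h, hh⟩
  have hfF : f ∈ F := ⟨hf, hf0, hf1, hfg⟩
  have hS0 : 0 ≤ S := (norm_nonneg _).trans (hle f hfF)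
  have step : ∀ h ∈ F, ∀ r : ℝ, 0 ≤ r → ∀ n : ℝ, 0 < n →
      (1 + r) * ‖cfc h c ∘L z‖ ≤ √(‖b‖ ^ 2 + r ^ 2 * S ^ 2) + r * ‖z‖ * (1 / n) := by
    intro h hh r hr n hn
    have hcont := hh.1
    -- `k` is again in the class `F`, and `h k` is within `1 / n` of `h`.
    let k : ℝ → ℝ := fun s => min 1 (n * h s)
    have hkF : k ∈ F := by
      refine ⟨by fun_prop, fun s => le_min zero_le_one (mul_nonneg hn.le (hh.2.1 s)),
        fun s => min_le_left _ _, fun s => ?_⟩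
      rcases mul_eq_zero.1 (hh.2.2.2 s) with h0 | h0
      · simp [k, h0]
      · rw [h0, mul_zero]
    have hkc : Continuous k := hkF.1
    have hsub : ‖cfc h c - cfc h c * cfc k c‖ ≤ 1 / n := by
      rw [← cfc_mul h k c hcont.continuousOn hkc.continuousOn,
        ← cfc_sub h (fun x => h x * k x) c hcont.continuousOn (by fun_prop)]
      exact norm_cfc_le (by positivity) fun s _ => abs_sub_mul_min_le (hh.2.1 s) hn
    have hkz : cfc k c ∘L z ∈ X := cfc_comp_mem hX hcX k hzX
    -- `p` fixes `k(c) z ∈ X`, so it sends `b + r k(c) z` to `z + r k(c) z`.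
    have hpb : p (b + (r : ℂ) • (cfc k c ∘L z)) = z + (r : ℂ) • (cfc k c ∘L z) := by
      rw [map_add, map_smul, hp.fix _ hkz]
    have horth : b† ∘L ((r : ℂ) • (cfc k c ∘L z)) = 0 := by
      have hgk : cfc g c * cfc k c = 0 := by
        rw [← cfc_mul g k c hg.continuousOn hkc.continuousOn]
        have : (fun s => g s * k s) = fun _ => (0 : ℝ) := by
          funext s
          rw [mul_comm]
          exact hkF.2.2.2 s
        rw [this, cfc_const_zero]
      have hga : (cfc g c)† = cfc g c := (cfc_predicate g c : IsSelfAdjoint (cfc g c))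
      rw [hb, ContinuousLinearMap.adjoint_comp, hga, ContinuousLinearMap.comp_smul,
        ContinuousLinearMap.comp_assoc, ← ContinuousLinearMap.comp_assoc (cfc g c)]
      rw [ContinuousLinearMap.mul_def] at hgk
      rw [hgk, ContinuousLinearMap.zero_comp, ContinuousLinearMap.comp_zero, smul_zero]
    have hn1 : ‖z + (r : ℂ) • (cfc k c ∘L z)‖ ≤ √(‖b‖ ^ 2 + r ^ 2 * S ^ 2) := by
      rw [← hpb]
      refine (hp.norm_le _ (add_mem hbT (T.smul_mem _ (hp.le hkz)))).trans ?_
      refine Real.le_sqrt_of_sq_le ((norm_add_sq_le_of_adjoint_comp_eq_zero horth).trans ?_)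
      rw [norm_smul, mul_pow, Complex.norm_real, Real.norm_eq_abs, sq_abs]
      gcongr
      exact hle k hkF
    have hn2 : ‖cfc h c ∘L (z + (r : ℂ) • (cfc k c ∘L z))‖ ≤ √(‖b‖ ^ 2 + r ^ 2 * S ^ 2) :=
      calc _ ≤ ‖cfc h c‖ * ‖z + (r : ℂ) • (cfc k c ∘L z)‖ :=
            ContinuousLinearMap.opNorm_comp_le _ _
        _ ≤ 1 * √(‖b‖ ^ 2 + r ^ 2 * S ^ 2) := by gcongr; exact hnorm h hh
        _ = _ := one_mul _
    have heq : ((1 + r : ℝ) : ℂ) • (cfc h c ∘L z) =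
        cfc h c ∘L (z + (r : ℂ) • (cfc k c ∘L z)) +
          (r : ℂ) • ((cfc h c - cfc h c * cfc k c) ∘L z) := by
      rw [ContinuousLinearMap.comp_add, ContinuousLinearMap.comp_smul,
        ContinuousLinearMap.sub_comp, ContinuousLinearMap.mul_def,
        ContinuousLinearMap.comp_assoc, smul_sub]
      push_cast
      rw [add_smul, one_smul]
      abel
    have hn3 : ‖(r : ℂ) • ((cfc h c - cfc h c * cfc k c) ∘L z)‖ ≤ r * ‖z‖ * (1 / n) := by
      rw [norm_smul, Complex.norm_real, Real.norm_eq_abs, abs_of_nonneg hr, mul_assoc,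
        mul_comm ‖z‖]
      gcongr
      exact (ContinuousLinearMap.opNorm_comp_le _ _).trans (by gcongr)
    calc (1 + r) * ‖cfc h c ∘L z‖ = ‖((1 + r : ℝ) : ℂ) • (cfc h c ∘L z)‖ := by
          rw [norm_smul, Complex.norm_real, Real.norm_eq_abs, abs_of_nonneg (by positivity)]
      _ ≤ _ := by
          rw [heq]
          exact (norm_add_le _ _).trans (add_le_add hn2 hn3)
  have step2 : ∀ h ∈ F, ∀ r : ℝ, 0 ≤ r →
      (1 + r) * ‖cfc h c ∘L z‖ ≤ √(‖b‖ ^ 2 + r ^ 2 * S ^ 2) := by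
    intro h hh r hr
    have hlim : Filter.Tendsto
        (fun n : ℝ => √(‖b‖ ^ 2 + r ^ 2 * S ^ 2) + r * ‖z‖ * (1 / n)) Filter.atTop
        (nhds (√(‖b‖ ^ 2 + r ^ 2 * S ^ 2) + r * ‖z‖ * 0)) := by
      refine tendsto_const_nhds.add (tendsto_const_nhds.mul ?_)
      exact (tendsto_inv_atTop_zero (𝕜 := ℝ)).congr fun n => (one_div n).symm
    rw [mul_zero, add_zero] at hlim
    exact ge_of_tendsto hlim ((Filter.eventually_gt_atTop 0).mono fun n hn => step h hh r hr n hn)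
  have hS : S = 0 := by
    refine eq_zero_of_forall_one_add_sq_mul_le (B := ‖b‖) fun r hr => ?_
    have hne : Nonempty F := ⟨⟨f, hfF⟩⟩
    have h1 : S ≤ √(‖b‖ ^ 2 + r ^ 2 * S ^ 2) / (1 + r) :=
      ciSup_le fun h => by
        rw [le_div_iff₀ (by positivity), mul_comm]
        exact step2 h h.2 r hr
    rw [le_div_iff₀ (by positivity), mul_comm] at h1
    calc (1 + r) ^ 2 * S ^ 2 = ((1 + r) * S) ^ 2 := by ring
      _ ≤ √(‖b‖ ^ 2 + r ^ 2 * S ^ 2) ^ 2 := by gcongr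
      _ = _ := Real.sq_sqrt (by positivity)
  exact norm_le_zero_iff.1 (hS ▸ hle f hfF)

end Multipliers

/-! ### Contractive projections are module maps -/

section Modularity

variable {H K : Type*} [NormedAddCommGroup H] [InnerProductSpace ℂ H] [CompleteSpace H]
  [NormedAddCommGroup K] [InnerProductSpace ℂ K] [CompleteSpace K]

theorem mul_norm_sq_le_sum_norm_cfc_apply_sq {ι : Type*} (I : Finset ι) {φ : ι → ℝ → ℝ}
    (hφ : ∀ i, Continuous (φ i)) {c : K →L[ℂ] K} (hc : IsSelfAdjoint c) {κ : ℝ}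
    (h : ∀ s ∈ spectrum ℝ c, κ ≤ ∑ i ∈ I, φ i s * φ i s) (w : K) :
    κ * ‖w‖ ^ 2 ≤ ∑ i ∈ I, ‖cfc (φ i) c w‖ ^ 2 := by
  have h0 : (0 : K →L[ℂ] K) ≤ cfc (fun s => (∑ i ∈ I, fun s => φ i s * φ i s) s - κ) c :=
    cfc_nonneg fun s hs => by
      rw [Finset.sum_apply, sub_nonneg]
      exact h s hs
  have hsum : Continuous (∑ i ∈ I, fun s => φ i s * φ i s) := by
    have : (∑ i ∈ I, fun s => φ i s * φ i s) = fun s => ∑ i ∈ I, φ i s * φ i s := by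
      ext s
      rw [Finset.sum_apply]
    rw [this]
    fun_prop
  rw [cfc_sub _ _ c hsum.continuousOn continuousOn_const, cfc_const _ c hc,
    cfc_sum _ c I fun i _ => by fun_prop] at h0
  have h1 := ((ContinuousLinearMap.nonneg_iff_isPositive _).1 h0).2 w
  rw [ContinuousLinearMap.reApplyInnerSelf_apply, sub_apply, inner_sub_left, map_sub,
    sub_nonneg, sum_apply, sum_inner, map_sum] at h1
  have h2 : ∀ i, RCLike.re (inner ℂ (cfc (fun s => φ i s * φ i s) c w) w) =
      ‖cfc (φ i) c w‖ ^ 2 := by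
    intro i
    rw [cfc_mul _ _ c (hφ i).continuousOn (hφ i).continuousOn, mul_apply_eq_comp]
    have hsa : (cfc (φ i) c)† = cfc (φ i) c := (cfc_predicate (φ i) c : IsSelfAdjoint _)
    rw [← ContinuousLinearMap.adjoint_inner_right, hsa, inner_self_eq_norm_sq]
  simp only [h2] at h1
  refine le_trans (le_of_eq ?_) h1
  rw [Algebra.algebraMap_eq_smul_one, smul_apply, one_apply_eq_self,
    inner_smul_left_eq_smul, RCLike.smul_re, inner_self_eq_norm_sq]

/-- If `p a = 0` then `p (c a) = p ((c - τ) a)`, and by locality the part of `c - τ` away from `τ`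
does not contribute under a tent function of width `δ` at `τ`. -/
theorem IsContrProj.norm_tent_comp_le {T X : Submodule ℂ (H →L[ℂ] K)}
    {p : (H →L[ℂ] K) →ₗ[ℂ] (H →L[ℂ] K)} (hp : IsContrProj T X p)
    (hT : IsClosed (T : Set (H →L[ℂ] K))) (hX : IsClosed (X : Set (H →L[ℂ] K)))
    {c : K →L[ℂ] K} (hcT : c ∈ leftMultiplier T) (hcX : c ∈ leftMultiplier X)
    (hc : IsSelfAdjoint c) {a : H →L[ℂ] K} (ha : a ∈ T) (hpa : p a = 0) {δ : ℝ} (hδ : 0 < δ)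
    (τ : ℝ) : ‖cfc (fun s => max 0 (1 - |s - τ| / δ)) c ∘L p (c ∘L a)‖ ≤ δ * ‖a‖ := by
  let φ : ℝ → ℝ := fun s => max 0 (1 - |s - τ| / δ)
  -- Cut `s - τ` off at `± δ`; the remainder `g` vanishes where `φ` does not.
  let d : ℝ → ℝ := fun s => max (-δ) (min δ (s - τ))
  let g : ℝ → ℝ := fun s => s - τ - d s
  have hd : Continuous d := by fun_prop
  have hg : Continuous g := by fun_prop
  have hφ : Continuous φ := by fun_prop
  have hφ0 : ∀ s, 0 ≤ φ s := fun s => le_max_left _ _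
  have hφ1 : ∀ s, φ s ≤ 1 := fun s =>
    max_le zero_le_one (by have : 0 ≤ |s - τ| / δ := by positivity
                           linarith)
  have hφg : ∀ s, φ s * g s = 0 := by
    intro s
    rcases le_total |s - τ| δ with h | h
    · obtain ⟨h1, h2⟩ := abs_le.1 h
      have : g s = 0 := by simp only [g, d, min_eq_right h2, max_eq_right h1, sub_self]
      rw [this, mul_zero]
    · have : φ s = 0 := max_eq_left (by
        have : 1 ≤ |s - τ| / δ := (one_le_div hδ).2 h
        linarith)
      rw [this, zero_mul]
  have hdn : ‖cfc d c‖ ≤ δ := norm_cfc_le hδ.le fun s _ => by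
    rw [Real.norm_eq_abs, abs_le]
    exact ⟨le_max_left _ _, max_le (by linarith) (min_le_left _ _)⟩
  have hφn : ‖cfc φ c‖ ≤ 1 := norm_cfc_le zero_le_one fun s _ => by
    rw [Real.norm_eq_abs, abs_of_nonneg (hφ0 s)]
    exact hφ1 s
  have hdec : c = algebraMap ℝ _ τ + cfc d c + cfc g c := by
    conv_lhs => rw [← cfc_id' ℝ c hc]
    rw [← cfc_const τ c hc, ← cfc_add c (fun _ => τ) d continuousOn_const hd.continuousOn,
      ← cfc_add c (fun s => τ + d s) g (by fun_prop) hg.continuousOn]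
    congr 1
    funext s
    simp only [g]
    ring
  have hca : c ∘L a = (τ : ℂ) • a + cfc d c ∘L a + cfc g c ∘L a := by
    conv_lhs => rw [hdec]
    rw [ContinuousLinearMap.add_comp, ContinuousLinearMap.add_comp,
      Algebra.algebraMap_eq_smul_one]
    congr 2
  have hloc := hp.cfc_comp_apply_eq_zero hT hX hcT hcX hφ hg hφ0 hφ1 hφg ha
  change ‖cfc φ c ∘L p (c ∘L a)‖ ≤ δ * ‖a‖
  rw [hca, map_add, map_add, map_smul, hpa, smul_zero, zero_add, ContinuousLinearMap.comp_add,
    hloc, add_zero]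
  calc ‖cfc φ c ∘L p (cfc d c ∘L a)‖ ≤ ‖cfc φ c‖ * ‖p (cfc d c ∘L a)‖ :=
        ContinuousLinearMap.opNorm_comp_le _ _
    _ ≤ 1 * ‖cfc d c ∘L a‖ := by
        gcongr
        exact hp.norm_le _ (cfc_comp_mem hT hcT d ha)
    _ ≤ ‖cfc d c‖ * ‖a‖ := by
        rw [one_mul]
        exact ContinuousLinearMap.opNorm_comp_le _ _
    _ ≤ δ * ‖a‖ := by gcongr

/-- The tents of width `δ` centred at the multiples of `δ` cover the line. -/
theorem quarter_le_sum_tent_sq {δ : ℝ} (hδ : 0 < δ) {m : ℕ} {s : ℝ} (hs : |s| ≤ m * δ) :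
    (1 / 4 : ℝ) ≤ ∑ j ∈ Finset.Icc (-m : ℤ) m,
      max 0 (1 - |s - j * δ| / δ) * max 0 (1 - |s - j * δ| / δ) := by
  have hround := abs_sub_round (s / δ)
  have hmem : round (s / δ) ∈ Finset.Icc (-m : ℤ) m := by
    have h1 : |s / δ| ≤ m := by
      rw [abs_div, abs_of_pos hδ, div_le_iff₀ hδ]
      exact hs
    obtain ⟨h2, h3⟩ := abs_le.1 h1
    obtain ⟨h4, h5⟩ := abs_le.1 hround
    have h6 : (round (s / δ) : ℝ) < ((m + 1 : ℤ) : ℝ) := by push_cast; linarith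
    have h7 : ((-m - 1 : ℤ) : ℝ) < (round (s / δ) : ℝ) := by push_cast; linarith
    rw [Finset.mem_Icc]
    exact ⟨by have := Int.cast_lt.1 h7; omega, by have := Int.cast_lt.1 h6; omega⟩
  have hle := Finset.single_le_sum
    (f := fun j : ℤ => max 0 (1 - |s - j * δ| / δ) * max 0 (1 - |s - j * δ| / δ))
    (fun j _ => mul_self_nonneg _) hmem
  refine le_trans ?_ hle
  have hval : |s - (round (s / δ) : ℝ) * δ| / δ = |s / δ - round (s / δ)| := by
    rw [← abs_of_pos hδ, ← abs_div, abs_of_pos hδ, sub_div, mul_div_cancel_right₀ _ hδ.ne']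
  have h2 : (1 / 2 : ℝ) ≤ max 0 (1 - |s - (round (s / δ) : ℝ) * δ| / δ) := by
    rw [hval]
    exact le_max_of_le_right (by linarith)
  nlinarith

/-- The kernel of a contractive projection is invariant under self-adjoint left multipliers. If
`p a = 0` then `p (c a)` is, near the point `τ` of the spectrum of `c`, equal to `p ((c - τ) a)`,
hence of norm `O(δ)` on a window of width `δ`; as there are only `O(1/δ)` windows, the square sum
of the pieces is `O(δ)`. -/
theorem IsContrProj.apply_comp_eq_zero {T X : Submodule ℂ (H →L[ℂ] K)}
    {p : (H →L[ℂ] K) →ₗ[ℂ] (H →L[ℂ] K)} (hp : IsContrProj T X p)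
    (hT : IsClosed (T : Set (H →L[ℂ] K))) (hX : IsClosed (X : Set (H →L[ℂ] K)))
    {c : K →L[ℂ] K} (hcT : c ∈ leftMultiplier T) (hcX : c ∈ leftMultiplier X)
    (hc : IsSelfAdjoint c) {a : H →L[ℂ] K} (ha : a ∈ T) (hpa : p a = 0) :
    p (c ∘L a) = 0 := by
  set z := p (c ∘L a) with hz
  set R : ℝ := ‖c‖ + 1 with hR
  have hRpos : 0 < R := by positivity
  have key : ∀ m : ℕ, ∀ v : H,
      1 / 4 * ‖z v‖ ^ 2 ≤ 3 * (R * ‖a‖ * ‖v‖) ^ 2 * (1 / ((m : ℝ) + 1)) := by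
    intro m v
    have hm : (0 : ℝ) < m + 1 := by positivity
    set δ : ℝ := R / (m + 1) with hδ'
    have hδ : 0 < δ := by positivity
    have h1 := mul_norm_sq_le_sum_norm_cfc_apply_sq (Finset.Icc (-(m + 1 : ℕ) : ℤ) (m + 1 : ℕ))
      (φ := fun j s => max 0 (1 - |s - j * δ| / δ)) (fun j => by fun_prop) hc (κ := 1 / 4)
      (fun s hs => quarter_le_sum_tent_sq hδ (by
        have h2 : |s| ≤ ‖c‖ := by
          have hs' := spectrum.norm_le_norm_mul_of_mem hs
          have hone : ‖(1 : K →L[ℂ] K)‖ ≤ 1 := ContinuousLinearMap.norm_id_le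
          rw [Real.norm_eq_abs] at hs'
          nlinarith [norm_nonneg c]
        rw [hδ']
        push_cast
        rw [mul_div_cancel₀ _ hm.ne']
        linarith)) (z v)
    refine h1.trans ?_
    have h3 : ∀ j ∈ Finset.Icc (-(m + 1 : ℕ) : ℤ) (m + 1 : ℕ),
        ‖cfc (fun s => max 0 (1 - |s - j * δ| / δ)) c (z v)‖ ^ 2 ≤ (δ * ‖a‖ * ‖v‖) ^ 2 := by
      intro j _
      have h4 := hp.norm_tent_comp_le hT hX hcT hcX hc ha hpa hδ (j * δ)
      have h5 := ((cfc (fun s => max 0 (1 - |s - j * δ| / δ)) c) ∘L z).le_of_opNorm_le h4 v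
      exact pow_le_pow_left₀ (norm_nonneg _) h5 2
    refine (Finset.sum_le_card_nsmul _ _ _ h3).trans ?_
    have hcard : (Finset.Icc (-(m + 1 : ℕ) : ℤ) (m + 1 : ℕ)).card = 2 * m + 3 := by
      rw [Int.card_Icc]
      omega
    rw [hcard, nsmul_eq_mul, hδ']
    push_cast
    have h6 : (R / (m + 1) * ‖a‖ * ‖v‖) ^ 2 = (R * ‖a‖ * ‖v‖) ^ 2 * (1 / (m + 1)) ^ 2 := by
      ring
    have h7 : (2 * (m : ℝ) + 3) * (1 / (m + 1)) ≤ 3 := by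
      rw [mul_one_div, div_le_iff₀ hm]
      nlinarith [(Nat.cast_nonneg m : (0 : ℝ) ≤ m)]
    calc (2 * (m : ℝ) + 3) * (R / (m + 1) * ‖a‖ * ‖v‖) ^ 2
        = (2 * (m : ℝ) + 3) * (1 / (m + 1)) * ((R * ‖a‖ * ‖v‖) ^ 2 * (1 / (m + 1))) := by
          rw [h6]; ring
      _ ≤ 3 * ((R * ‖a‖ * ‖v‖) ^ 2 * (1 / (m + 1))) := by gcongr
      _ = _ := by ring
  refine ContinuousLinearMap.ext fun v => ?_
  have hlim := (tendsto_one_div_add_atTop_nhds_zero_nat (𝕜 := ℝ)).const_mul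
    (3 * (R * ‖a‖ * ‖v‖) ^ 2)
  rw [mul_zero] at hlim
  have h0 : 1 / 4 * ‖z v‖ ^ 2 ≤ 0 := ge_of_tendsto' hlim fun m => key m v
  have h1 : ‖z v‖ = 0 := by nlinarith [norm_nonneg (z v)]
  simpa using h1

/-- A contractive projection of `T` onto `X` commutes with the self-adjoint left multipliers
common to `T` and `X`. -/
theorem IsContrProj.apply_comp_of_isSelfAdjoint {T X : Submodule ℂ (H →L[ℂ] K)}
    {p : (H →L[ℂ] K) →ₗ[ℂ] (H →L[ℂ] K)} (hp : IsContrProj T X p)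
    (hT : IsClosed (T : Set (H →L[ℂ] K))) (hX : IsClosed (X : Set (H →L[ℂ] K)))
    {c : K →L[ℂ] K} (hcT : c ∈ leftMultiplier T) (hcX : c ∈ leftMultiplier X)
    (hc : IsSelfAdjoint c) {t : H →L[ℂ] K} (ht : t ∈ T) : p (c ∘L t) = c ∘L p t := by
  have hpt := hp.mem t ht
  have h := hp.apply_comp_eq_zero hT hX hcT hcX hc (sub_mem ht (hp.le hpt))
    (by rw [map_sub, hp.fix _ hpt, sub_self])
  rwa [ContinuousLinearMap.comp_sub, map_sub, hp.fix _ (hcX _ hpt).1, sub_eq_zero] at h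

theorem leftAlg_mono {X T : Submodule ℂ (H →L[ℂ] K)} (h : X ≤ T) : leftAlg X ≤ leftAlg T := by
  refine closedSpan_mono ?_
  rintro _ ⟨t, ht, s, hs, rfl⟩
  exact ⟨t, h ht, s, h hs, rfl⟩

theorem IsTRO.mem_leftMultiplier {T : Submodule ℂ (H →L[ℂ] K)} (hT : IsTRO T) {c : K →L[ℂ] K}
    (hc : c ∈ leftAlg T) : c ∈ leftMultiplier T := fun _ hv =>
  ⟨hT.leftAlg_comp hc hv, hT.leftAlg_comp (adjoint_mem_leftAlg hc) hv⟩

/-- A contractive projection onto a sub-TRO is a left module map. -/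
theorem IsContrProj.apply_leftAlg_comp {T X : Submodule ℂ (H →L[ℂ] K)}
    {p : (H →L[ℂ] K) →ₗ[ℂ] (H →L[ℂ] K)} (hp : IsContrProj T X p) (hT : IsTRO T) (hX : IsTRO X)
    {c : K →L[ℂ] K} (hc : c ∈ leftAlg X) {t : H →L[ℂ] K} (ht : t ∈ T) :
    p (c ∘L t) = c ∘L p t := by
  have hcX := hX.mem_leftMultiplier hc
  have hcT := hT.mem_leftMultiplier (leftAlg_mono hp.le hc)
  have hre : ∀ {V : Submodule ℂ (H →L[ℂ] K)}, c ∈ leftMultiplier V →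
      (realPart c : K →L[ℂ] K) ∈ leftMultiplier V := fun h => by
    rw [realPart_apply_coe]
    exact SMulMemClass.ofIsScalarTower (StarSubalgebra ℂ (K →L[ℂ] K)) ℝ ℂ (K →L[ℂ] K) |>.smul_mem _
      (add_mem h (star_mem h))
  have him : ∀ {V : Submodule ℂ (H →L[ℂ] K)}, c ∈ leftMultiplier V →
      (imaginaryPart c : K →L[ℂ] K) ∈ leftMultiplier V := fun h => by
    rw [imaginaryPart_apply_coe]
    exact SMulMemClass.smul_mem _
      (SMulMemClass.ofIsScalarTower (StarSubalgebra ℂ (K →L[ℂ] K)) ℝ ℂ (K →L[ℂ] K) |>.smul_mem _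
        (sub_mem h (star_mem h)))
  have h1 := hp.apply_comp_of_isSelfAdjoint hT.isClosed hX.isClosed (hre hcT) (hre hcX)
    (realPart c).2 ht
  have h2 := hp.apply_comp_of_isSelfAdjoint hT.isClosed hX.isClosed (him hcT) (him hcX)
    (imaginaryPart c).2 ht
  conv_lhs => rw [← realPart_add_I_smul_imaginaryPart c]
  conv_rhs => rw [← realPart_add_I_smul_imaginaryPart c]
  rw [ContinuousLinearMap.add_comp, ContinuousLinearMap.smul_comp, map_add, map_smul, h1, h2,
    ContinuousLinearMap.add_comp, ContinuousLinearMap.smul_comp]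

end Modularity

/-! ### Norms computed from the action on a set of operators -/

section Isometry

variable {H K : Type*} [NormedAddCommGroup H] [InnerProductSpace ℂ H] [CompleteSpace H]
  [NormedAddCommGroup K] [InnerProductSpace ℂ K] [CompleteSpace K]

theorem le_of_forall_pow_mul_le {x y ε C : ℝ} (hy : 0 ≤ y) (hε : 0 < ε)
    (h : ∀ n : ℕ, x ^ (2 ^ n - 1) * ε ≤ y ^ (2 ^ n - 1) * C) : x ≤ y := by
  by_contra! hxy
  have hx : 0 < x := hy.trans_lt hxy
  have h1 : ∀ n : ℕ, ε ≤ (y / x) ^ (2 ^ n - 1) * C := by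
    intro n
    rw [div_pow, div_mul_eq_mul_div, le_div_iff₀ (by positivity), mul_comm]
    exact h n
  have h2 : Filter.Tendsto (fun n : ℕ => 2 ^ n - 1) Filter.atTop Filter.atTop :=
    Filter.tendsto_atTop_mono (fun n => Nat.le_sub_one_of_lt n.lt_two_pow_self) Filter.tendsto_id
  have h3 := (((tendsto_pow_atTop_nhds_zero_of_lt_one (by positivity)
    ((div_lt_one hx).2 hxy)).comp h2).mul_const C)
  rw [zero_mul] at h3
  exact absurd (ge_of_tendsto' h3 h1) (not_le.2 hε)

/-- The norm of `b ∈ B(K)` can be computed from its left action on a set `Y ⊆ B(H, K)` invariant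
under `b` and `b*`, provided `b` lies in the closed right ideal generated by `Y`. For `e = b* b`
the powers `e ^ n` grow no faster than `k ^ (2 n)` on `Y`, hence also when applied to an element of
the ideal close to `e`, whereas `‖e ^ (n + 1)‖ = ‖e‖ ^ (n + 1)`. -/
theorem norm_le_of_forall_norm_comp_le {Y : Set (H →L[ℂ] K)} {b : K →L[ℂ] K} {k : ℝ}
    (hk : 0 ≤ k) (hbY : ∀ y ∈ Y, b ∘L y ∈ Y) (hbY' : ∀ y ∈ Y, b† ∘L y ∈ Y)
    (h : ∀ y ∈ Y, ‖b ∘L y‖ ≤ k * ‖y‖)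
    (hb : b ∈ closedSpan {w : K →L[ℂ] K | ∃ y ∈ Y, ∃ v : K →L[ℂ] H, w = y ∘L v}) : ‖b‖ ≤ k := by
  set W : Set (K →L[ℂ] K) := {w | ∃ y ∈ Y, ∃ v : K →L[ℂ] H, w = y ∘L v} with hW
  have h' : ∀ y ∈ Y, ‖b† ∘L y‖ ≤ k * ‖y‖ := by
    intro y hy
    rcases (norm_nonneg (b† ∘L y)).eq_or_lt with h0 | h0
    · rw [← h0]
      positivity
    · have h1 : ‖b† ∘L y‖ * ‖b† ∘L y‖ ≤ ‖y‖ * (k * ‖b† ∘L y‖) := by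
        rw [← ContinuousLinearMap.norm_adjoint_comp_self, ContinuousLinearMap.adjoint_comp,
          ContinuousLinearMap.adjoint_adjoint, ContinuousLinearMap.comp_assoc]
        refine (ContinuousLinearMap.opNorm_comp_le _ _).trans ?_
        rw [LinearIsometryEquiv.norm_map]
        gcongr
        exact h _ (hbY' y hy)
      exact le_of_mul_le_mul_right (by linarith) h0
  set e : K →L[ℂ] K := b† ∘L b with he
  have hesa : IsSelfAdjoint e := IsSelfAdjoint.star_mul_self b
  have hpow : ∀ n : ℕ, ∀ y ∈ Y, (e ^ n) ∘L y ∈ Y ∧ ‖(e ^ n) ∘L y‖ ≤ (k ^ 2) ^ n * ‖y‖ := by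
    intro n
    induction n with
    | zero =>
      intro y hy
      have h1 : (e ^ 0) ∘L y = y := by rw [pow_zero]; rfl
      rw [h1, pow_zero, one_mul]
      exact ⟨hy, le_rfl⟩
    | succ n ih =>
      intro y hy
      obtain ⟨h1, h2⟩ := ih y hy
      have h3 : (e ^ (n + 1)) ∘L y = b† ∘L (b ∘L ((e ^ n) ∘L y)) := by rw [pow_succ']; rfl
      rw [h3]
      refine ⟨hbY' _ (hbY _ h1), (h' _ (hbY _ h1)).trans ?_⟩
      calc k * ‖b ∘L ((e ^ n) ∘L y)‖ ≤ k * (k * ((k ^ 2) ^ n * ‖y‖)) := by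
            gcongr
            exact (h _ h1).trans (by gcongr)
        _ = _ := by ring
  have hspan : ∀ w ∈ Submodule.span ℂ W, ∃ C : ℝ, ∀ n : ℕ, ‖(e ^ n) * w‖ ≤ (k ^ 2) ^ n * C := by
    intro w hw
    induction hw using Submodule.span_induction with
    | mem w hw =>
      obtain ⟨y, hy, v, rfl⟩ := hw
      refine ⟨‖y‖ * ‖v‖, fun n => ?_⟩
      rw [ContinuousLinearMap.mul_def, ← ContinuousLinearMap.comp_assoc, ← mul_assoc]
      exact (ContinuousLinearMap.opNorm_comp_le _ _).trans
        (mul_le_mul_of_nonneg_right (hpow n y hy).2 (norm_nonneg _))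
    | zero => exact ⟨0, fun n => by simp⟩
    | add w w' _ _ h1 h2 =>
      obtain ⟨C, hC⟩ := h1
      obtain ⟨C', hC'⟩ := h2
      refine ⟨C + C', fun n => ?_⟩
      rw [mul_add, mul_add]
      exact norm_add_le_of_le (hC n) (hC' n)
    | smul a w _ h1 =>
      obtain ⟨C, hC⟩ := h1
      refine ⟨‖a‖ * C, fun n => ?_⟩
      rw [mul_smul_comm, norm_smul, mul_left_comm]
      exact mul_le_mul_of_nonneg_left (hC n) (norm_nonneg _)
  have heW : e ∈ closedSpan W := by
    refine map_closedSpan (closedSpan W) (isClosed_closedSpan _)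
      (ContinuousLinearMap.compL ℂ K K K (b†)) ?_ b hb
    rintro _ ⟨y, hy, v, rfl⟩
    exact subset_closedSpan ⟨b† ∘L y, hbY' y hy, v, rfl⟩
  have hnorm : ‖e‖ = ‖b‖ * ‖b‖ := ContinuousLinearMap.norm_adjoint_comp_self b
  have hek : ‖e‖ ≤ k ^ 2 := by
    rcases (norm_nonneg e).eq_or_lt with h0 | h0
    · rw [← h0]
      positivity
    · have hcl : e ∈ closure (Submodule.span ℂ W : Set (K →L[ℂ] K)) := heW
      obtain ⟨w, hw, hwe⟩ := Metric.mem_closure_iff.1 hcl (‖e‖ / 2) (by positivity)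
      rw [dist_eq_norm] at hwe
      obtain ⟨C, hC⟩ := hspan w hw
      refine le_of_forall_pow_mul_le (ε := ‖e‖ / 2) (C := C) (by positivity) (by positivity)
        fun n => ?_
      set N := 2 ^ n - 1 with hN
      have hN1 : N + 1 = 2 ^ n := Nat.sub_add_cancel Nat.one_le_two_pow
      have h1 : ‖e‖ ^ (N + 1) = ‖e ^ (N + 1)‖ := by
        rw [hN1, hesa.norm_pow_two_pow]
      have h2 : e ^ (N + 1) = e ^ N * (e - w) + e ^ N * w := by
        rw [mul_sub, pow_succ, sub_add_cancel]
      have hNn : ‖e ^ N‖ ≤ ‖e‖ ^ N := by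
        rcases Nat.eq_zero_or_pos N with h3 | h3
        · rw [h3, pow_zero, pow_zero]
          exact ContinuousLinearMap.norm_id_le
        · exact norm_pow_le' e h3
      have h4 : ‖e ^ N * (e - w)‖ ≤ ‖e‖ ^ N * (‖e‖ / 2) :=
        (norm_mul_le _ _).trans (mul_le_mul hNn hwe.le (norm_nonneg _) (by positivity))
      have h5 : ‖e‖ ^ (N + 1) ≤ ‖e‖ ^ N * (‖e‖ / 2) + (k ^ 2) ^ N * C := by
        rw [h1, h2]
        exact norm_add_le_of_le h4 (hC N)
      rw [pow_succ] at h5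
      linarith
  rw [hnorm, ← sq] at hek
  exact (pow_le_pow_iff_left₀ (norm_nonneg _) hk two_ne_zero).1 hek

end Isometry

/-! ### Positivity of contractive bimodule projections -/

section Positivity

variable {L : Type*} [NormedAddCommGroup L] [InnerProductSpace ℂ L] [CompleteSpace L]

/-- A closed star subalgebra has a self-adjoint contractive two-sided approximate unit. -/
theorem exists_approximate_unit (B : NonUnitalStarSubalgebra ℂ (L →L[ℂ] L))
    (hB : IsClosed (B : Set (L →L[ℂ] L))) :
    ∃ l : Filter (L →L[ℂ] L), l.NeBot ∧ (∀ᶠ u in l, u ∈ B ∧ IsSelfAdjoint u ∧ ‖u‖ ≤ 1) ∧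
      (∀ b ∈ B, Filter.Tendsto (fun u => u * b) l (nhds b)) ∧
      ∀ b ∈ B, Filter.Tendsto (fun u => b * u) l (nhds b) := by
  have : IsClosed (B : Set (L →L[ℂ] L)) := hB
  let _ : PartialOrder B := CStarAlgebra.spectralOrder B
  have : StarOrderedRing B := CStarAlgebra.spectralOrderedRing B
  have hl := CStarAlgebra.increasingApproximateUnit B
  have hne := hl.neBot
  refine ⟨(CStarAlgebra.approximateUnit B).map (Subtype.val : B → L →L[ℂ] L), hne.map _,
    ?_, ?_, ?_⟩
  · rw [Filter.eventually_map]
    filter_upwards [hl.eventually_nonneg, hl.eventually_norm] with u hu hu1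
    exact ⟨u.2, congrArg Subtype.val (IsSelfAdjoint.of_nonneg hu).star_eq, hu1⟩
  · intro b hb
    rw [Filter.tendsto_map'_iff]
    exact (continuous_subtype_val.tendsto _).comp (hl.tendsto_mul_right ⟨b, hb⟩)
  · intro b hb
    rw [Filter.tendsto_map'_iff]
    exact (continuous_subtype_val.tendsto _).comp (hl.tendsto_mul_left ⟨b, hb⟩)

/-- The relation between an operator `a` and its image `b ∈ B` under a contractive `B`-bimodule
projection onto `B`: compressing both by `u ∈ B` and subtracting a multiple of `u²` (which is
fixed by the projection) does not increase the norm. -/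
def IsCompressionDominated (B : NonUnitalStarSubalgebra ℂ (L →L[ℂ] L)) (b a : L →L[ℂ] L) : Prop :=
  ∀ u ∈ B, ∀ w : ℂ, ‖u * b * u - w • (u * u)‖ ≤ ‖u * a * u - w • (u * u)‖

variable {B : NonUnitalStarSubalgebra ℂ (L →L[ℂ] L)} {a b : L →L[ℂ] L}

/-- Any disc containing the numerical range of `a` (in the sense `‖a - w‖ ≤ r`) contains that of
`b`, on the range of `B`. -/
theorem IsCompressionDominated.norm_sub_le (h : IsCompressionDominated B b a)
    (hB : IsClosed (B : Set (L →L[ℂ] L))) (hb : b ∈ B) {w : ℂ} {r : ℝ} (hr : ‖a - w • 1‖ ≤ r)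
    {u : L →L[ℂ] L} (hu : u ∈ B) (ζ : L) : ‖b (u ζ) - w • u ζ‖ ≤ r * ‖u ζ‖ := by
  obtain ⟨l, hl, hlB, hleft, -⟩ := exists_approximate_unit B hB
  have h1 : Filter.Tendsto (fun v : L →L[ℂ] L => v * b * v * u - w • (v * v * u)) l
      (nhds (b * u - w • u)) := by
    have h2 : Filter.Tendsto (fun v : L →L[ℂ] L => v * b * (v * u)) l (nhds (b * u)) :=
      (hleft b hb).mul (hleft u hu)
    have h3 : Filter.Tendsto (fun v : L →L[ℂ] L => v * (v * u)) l (nhds u) := by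
      have h4 : Filter.Tendsto (fun v : L →L[ℂ] L => v * (v * u - u)) l (nhds 0) := by
        have h5 : Filter.Tendsto (fun v : L →L[ℂ] L => ‖v * u - u‖) l (nhds 0) :=
          tendsto_iff_norm_sub_tendsto_zero.1 (hleft u hu)
        refine squeeze_zero_norm' ?_ h5
        filter_upwards [hlB] with v hv
        calc ‖v * (v * u - u)‖ ≤ ‖v‖ * ‖v * u - u‖ := norm_mul_le _ _
          _ ≤ 1 * ‖v * u - u‖ := by gcongr; exact hv.2.2
          _ = _ := one_mul _
      have h6 := h4.add (hleft u hu)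
      rw [zero_add] at h6
      refine h6.congr fun v => ?_
      rw [mul_sub, sub_add_cancel]
    have h7 := h2.sub (h3.const_smul w)
    refine h7.congr fun v => ?_
    simp only [mul_assoc]
  have h1ζ := ((ContinuousLinearMap.apply ℂ L ζ).continuous.tendsto _).comp h1
  refine le_of_tendsto h1ζ.norm ?_
  filter_upwards [hlB] with v ⟨hvB, hvsa, hv1⟩
  have h8 : v * b * v * u - w • (v * v * u) = (v * b * v - w • (v * v)) * u := by
    rw [sub_mul, smul_mul_assoc]
  have h9 : v * a * v - w • (v * v) = v * (a - w • 1) * v := by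
    rw [mul_sub, sub_mul, mul_smul_comm, smul_mul_assoc, mul_one]
  change ‖(v * b * v * u - w • (v * v * u)) ζ‖ ≤ _
  rw [h8, mul_apply_eq_comp]
  refine (ContinuousLinearMap.le_opNorm _ _).trans ?_
  refine mul_le_mul_of_nonneg_right ((h v hvB w).trans ?_) (norm_nonneg _)
  rw [h9]
  calc ‖v * (a - w • 1) * v‖ ≤ ‖v‖ * ‖a - w • 1‖ * ‖v‖ :=
        (norm_mul_le _ _).trans (mul_le_mul_of_nonneg_right (norm_mul_le _ _) (norm_nonneg _))
    _ ≤ 1 * r * 1 := by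
        have hr0 : 0 ≤ r := (norm_nonneg _).trans hr
        gcongr
    _ = r := by ring

theorem IsCompressionDominated.norm_inner_sub_le (h : IsCompressionDominated B b a)
    (hB : IsClosed (B : Set (L →L[ℂ] L))) (hb : b ∈ B) {w : ℂ} {r : ℝ} (hr : ‖a - w • 1‖ ≤ r)
    {u : L →L[ℂ] L} (hu : u ∈ B) (ζ : L) :
    ‖inner ℂ (u ζ) (b (u ζ)) - w * (‖u ζ‖ : ℂ) ^ 2‖ ≤ r * ‖u ζ‖ ^ 2 := by
  have h1 : inner ℂ (u ζ) (b (u ζ)) - w * (‖u ζ‖ : ℂ) ^ 2 =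
      inner ℂ (u ζ) (b (u ζ) - w • u ζ) := by
    rw [inner_sub_right, inner_smul_right, inner_self_eq_norm_sq_to_K]
    rfl
  rw [h1]
  refine (norm_inner_le_norm _ _).trans ?_
  have := h.norm_sub_le hB hb hr hu ζ
  nlinarith [norm_nonneg (u ζ)]

/-- The numerical range of `b ∈ B` is determined, up to closure, on vectors in the range of `B`. -/
theorem inner_apply_mem_of_forall_mem_range (hB : IsClosed (B : Set (L →L[ℂ] L))) (hb : b ∈ B)
    {S : Set ℂ} (hS : IsClosed S) (h : ∀ u ∈ B, ∀ ζ, inner ℂ (u ζ) (b (u ζ)) ∈ S) (ζ : L) :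
    inner ℂ ζ (b ζ) ∈ S := by
  obtain ⟨l, hl, hlB, hleft, hright⟩ := exists_approximate_unit B hB
  have h2 : Filter.Tendsto (fun v : L →L[ℂ] L => inner ℂ (v ζ) (b (v ζ))) l
      (nhds (inner ℂ ζ (b ζ))) := by
    have h4 : Filter.Tendsto (fun v : L →L[ℂ] L => v * (b * v)) l (nhds b) := by
      have h5 : Filter.Tendsto (fun v : L →L[ℂ] L => v * (b * v - b)) l (nhds 0) := by
        have h6 : Filter.Tendsto (fun v : L →L[ℂ] L => ‖b * v - b‖) l (nhds 0) :=
          tendsto_iff_norm_sub_tendsto_zero.1 (hright b hb)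
        refine squeeze_zero_norm' ?_ h6
        filter_upwards [hlB] with v hv
        calc ‖v * (b * v - b)‖ ≤ ‖v‖ * ‖b * v - b‖ := norm_mul_le _ _
          _ ≤ 1 * ‖b * v - b‖ := by gcongr; exact hv.2.2
          _ = _ := one_mul _
      have h6 := h5.add (hleft b hb)
      rw [zero_add] at h6
      refine h6.congr fun v => ?_
      rw [mul_sub, sub_add_cancel]
    have h7 : Filter.Tendsto (fun v : L →L[ℂ] L => inner ℂ ζ ((v * (b * v)) ζ)) l
        (nhds (inner ℂ ζ (b ζ))) :=
      Filter.Tendsto.inner tendsto_const_nhds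
        (((ContinuousLinearMap.apply ℂ L ζ).continuous.tendsto _).comp h4)
    refine h7.congr' ?_
    filter_upwards [hlB] with v ⟨_, hvsa, _⟩
    have hv : v† = v := hvsa
    change inner ℂ ζ (v (b (v ζ))) = _
    rw [← ContinuousLinearMap.adjoint_inner_left, hv]
  refine hS.mem_of_tendsto h2 ?_
  filter_upwards [hlB] with v hv
  exact h v hv.1 ζ

theorem norm_sub_I_smul_le_sqrt (ha : IsSelfAdjoint a) (s : ℝ) :
    ‖a - (Complex.I * s) • (1 : L →L[ℂ] L)‖ ≤ √(‖a‖ ^ 2 + s ^ 2) := by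
  refine Real.le_sqrt_of_sq_le ?_
  rw [sq, ← CStarRing.norm_star_mul_self]
  have h1 : star (a - (Complex.I * s) • (1 : L →L[ℂ] L)) * (a - (Complex.I * s) • 1) =
      a * a + ((s ^ 2 : ℝ) : ℂ) • 1 := by
    rw [star_sub, star_smul, ha.star_eq, star_one]
    simp only [sub_mul, mul_sub, smul_mul_assoc, mul_smul_comm, one_mul, mul_one]
    have h2 : star (Complex.I * (s : ℂ)) = -(Complex.I * s) := by simp
    have h3 : Complex.I * (s : ℂ) * (Complex.I * s) = -((s ^ 2 : ℝ) : ℂ) := by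
      push_cast
      linear_combination ((s : ℂ) ^ 2) * Complex.I_mul_I
    simp only [h2, neg_smul, smul_sub, smul_neg, smul_smul, h3]
    abel
  rw [h1]
  refine (norm_add_le _ _).trans (add_le_add ?_ ?_)
  · rw [sq]
    exact norm_mul_le _ _
  · rw [norm_smul, Complex.norm_real, Real.norm_eq_abs, abs_of_nonneg (sq_nonneg s)]
    have : ‖(1 : L →L[ℂ] L)‖ ≤ 1 := ContinuousLinearMap.norm_id_le
    nlinarith [sq_nonneg s]

/-- A complex number lying in all discs of centre `i s κ` and radius `√(R² + s²) κ` is real. -/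
theorem im_eq_zero_of_forall_norm_sub_le {z : ℂ} {R κ : ℝ}
    (h : ∀ s : ℝ, ‖z - Complex.I * s * κ‖ ≤ √(R ^ 2 + s ^ 2) * κ) : z.im = 0 := by
  have h1 : ∀ s : ℝ, z.re ^ 2 + (z.im - s * κ) ^ 2 ≤ (R ^ 2 + s ^ 2) * κ ^ 2 := by
    intro s
    have h2 := pow_le_pow_left₀ (norm_nonneg _) (h s) 2
    rw [mul_pow, Real.sq_sqrt (by positivity), ← Complex.normSq_eq_norm_sq,
      Complex.normSq_apply] at h2
    have hre : (z - Complex.I * s * κ).re = z.re := by simp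
    have him : (z - Complex.I * s * κ).im = z.im - s * κ := by simp
    rw [hre, him] at h2
    nlinarith
  by_contra him
  by_cases hκ : κ = 0
  · have := h1 0
    rw [hκ] at this
    have h3 : 0 < z.im ^ 2 := by positivity
    nlinarith [sq_nonneg z.re]
  · have h2 := h1 (-(R ^ 2 * κ ^ 2) / (2 * z.im * κ))
    have h3 : -(R ^ 2 * κ ^ 2) / (2 * z.im * κ) * (2 * z.im * κ) = -(R ^ 2 * κ ^ 2) :=
      div_mul_cancel₀ _ (by positivity)
    have h4 : 0 < z.im ^ 2 := by positivity
    nlinarith [sq_nonneg z.re]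

theorem IsCompressionDominated.im_inner_eq_zero (h : IsCompressionDominated B b a)
    (hB : IsClosed (B : Set (L →L[ℂ] L))) (hb : b ∈ B) (ha : IsSelfAdjoint a) (ζ : L) :
    (inner ℂ ζ (b ζ) : ℂ).im = 0 := by
  refine inner_apply_mem_of_forall_mem_range (S := {z | z.im = 0}) hB hb
    (isClosed_eq Complex.continuous_im continuous_const) (fun u hu ζ => ?_) ζ
  refine im_eq_zero_of_forall_norm_sub_le (R := ‖a‖) (κ := ‖u ζ‖ ^ 2) fun s => ?_
  have := h.norm_inner_sub_le hB hb (norm_sub_I_smul_le_sqrt ha s) hu ζ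
  push_cast
  exact this

/-- Tomiyama: contractive conditional expectations preserve self-adjointness. -/
theorem IsCompressionDominated.isSelfAdjoint (h : IsCompressionDominated B b a)
    (hB : IsClosed (B : Set (L →L[ℂ] L))) (hb : b ∈ B) (ha : IsSelfAdjoint a) :
    IsSelfAdjoint b := by
  rw [ContinuousLinearMap.isSelfAdjoint_iff_isSymmetric,
    LinearMap.isSymmetric_iff_inner_map_self_real]
  intro v
  rw [inner_conj_symm]
  have h1 : (starRingEnd ℂ) (inner ℂ v (b v)) = inner ℂ v (b v) :=
    Complex.conj_eq_iff_im.2 (h.im_inner_eq_zero hB hb ha v)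
  rw [inner_conj_symm] at h1
  exact h1.symm

/-- Tomiyama: contractive conditional expectations are positive. -/
theorem IsCompressionDominated.isPositive (h : IsCompressionDominated B b a)
    (hB : IsClosed (B : Set (L →L[ℂ] L))) (hb : b ∈ B) (ha : a.IsPositive) : b.IsPositive := by
  refine ⟨(ContinuousLinearMap.isSelfAdjoint_iff_isSymmetric).1
    (h.isSelfAdjoint hB hb ha.isSelfAdjoint), fun ζ => ?_⟩
  have ha0 : 0 ≤ a := (ContinuousLinearMap.nonneg_iff_isPositive a).2 ha
  have hdisc : ‖a - (‖a‖ : ℂ) • (1 : L →L[ℂ] L)‖ ≤ ‖a‖ := by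
    have h1 : a ≤ algebraMap ℝ _ ‖a‖ := IsSelfAdjoint.le_algebraMap_norm_self ha.isSelfAdjoint
    have h2 : algebraMap ℝ (L →L[ℂ] L) ‖a‖ = (‖a‖ : ℂ) • (1 : L →L[ℂ] L) := by
      rw [Algebra.algebraMap_eq_smul_one]
      rfl
    rw [norm_sub_rev, ← h2]
    exact (CStarAlgebra.norm_le_iff_le_algebraMap _ (norm_nonneg a) (sub_nonneg.2 h1)).2
      (sub_le_self _ ha0)
  rw [ContinuousLinearMap.reApplyInnerSelf_apply, ← inner_conj_symm, RCLike.conj_re]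
  refine inner_apply_mem_of_forall_mem_range (S := {z | 0 ≤ z.re}) hB hb
    (isClosed_le continuous_const Complex.continuous_re) (fun u hu ζ => ?_) ζ
  have h3 := h.norm_inner_sub_le hB hb hdisc hu ζ
  have h4 := (Complex.abs_re_le_norm _).trans h3
  have h5 : ((inner ℂ (u ζ) (b (u ζ)) : ℂ) - (‖a‖ : ℂ) * (‖u ζ‖ : ℂ) ^ 2).re =
      (inner ℂ (u ζ) (b (u ζ)) : ℂ).re - ‖a‖ * ‖u ζ‖ ^ 2 := by
    rw [Complex.sub_re, ← Complex.ofReal_pow, ← Complex.ofReal_mul, Complex.ofReal_re]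
  rw [h5] at h4
  change 0 ≤ (inner ℂ (u ζ) (b (u ζ)) : ℂ).re
  linarith [(abs_le.1 h4).1]

end Positivity

/-! ### The adjoint TRO -/

section Adjoint

variable {H K : Type*} [NormedAddCommGroup H] [InnerProductSpace ℂ H] [CompleteSpace H]
  [NormedAddCommGroup K] [InnerProductSpace ℂ K] [CompleteSpace K]

/-- The space `T* = {t* | t ∈ T}` of operators `K → H`; it exchanges left and right. -/
def adjointSpace (T : Submodule ℂ (H →L[ℂ] K)) : Submodule ℂ (K →L[ℂ] H) where
  carrier := {s | s† ∈ T}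
  zero_mem' := by
    rw [Set.mem_ofPred_eq, map_zero]
    exact zero_mem T
  add_mem' := fun ha hb => by
    rw [Set.mem_ofPred_eq, map_add]
    exact add_mem ha hb
  smul_mem' := fun z _ ha => by
    rw [Set.mem_ofPred_eq, map_smulₛₗ]
    exact T.smul_mem _ ha

theorem mem_adjointSpace {T : Submodule ℂ (H →L[ℂ] K)} {s : K →L[ℂ] H} :
    s ∈ adjointSpace T ↔ s† ∈ T := Iff.rfl

theorem adjoint_mem_adjointSpace {T : Submodule ℂ (H →L[ℂ] K)} {t : H →L[ℂ] K} (ht : t ∈ T) :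
    t† ∈ adjointSpace T := by
  rwa [mem_adjointSpace, ContinuousLinearMap.adjoint_adjoint]

/-- The map `s ↦ p(s*)*`, that is `P†` in terms of `P`. -/
def adjointMap (p : (H →L[ℂ] K) →ₗ[ℂ] (H →L[ℂ] K)) : (K →L[ℂ] H) →ₗ[ℂ] (K →L[ℂ] H) where
  toFun s := (p (s†))†
  map_add' a b := by rw [map_add, map_add, map_add]
  map_smul' z a := by
    rw [map_smulₛₗ, map_smul, map_smulₛₗ, starRingEnd_self_apply, RingHom.id_apply]

theorem adjointMap_apply (p : (H →L[ℂ] K) →ₗ[ℂ] (H →L[ℂ] K)) (s : K →L[ℂ] H) :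
    adjointMap p s = (p (s†))† := rfl

theorem IsTRO.adjointSpace {T : Submodule ℂ (H →L[ℂ] K)} (hT : IsTRO T) :
    IsTRO (adjointSpace T) where
  isClosed := hT.isClosed.preimage
    (ContinuousLinearMap.adjoint (𝕜 := ℂ) (E := K) (F := H)).continuous
  triple_mem r hr s hs t ht := by
    rw [mem_adjointSpace, ContinuousLinearMap.adjoint_comp, ContinuousLinearMap.adjoint_comp,
      ContinuousLinearMap.comp_assoc]
    exact hT.triple_mem _ ht _ hs _ hr

theorem IsContrProj.adjointSpace {T X : Submodule ℂ (H →L[ℂ] K)}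
    {p : (H →L[ℂ] K) →ₗ[ℂ] (H →L[ℂ] K)} (hp : IsContrProj T X p) :
    IsContrProj (adjointSpace T) (adjointSpace X) (adjointMap p) where
  le _ hs := hp.le hs
  mem s hs := by
    rw [adjointMap_apply]
    exact adjoint_mem_adjointSpace (hp.mem _ hs)
  fix s hs := by
    rw [adjointMap_apply, hp.fix _ hs, ContinuousLinearMap.adjoint_adjoint]
  norm_le s hs := by
    rw [adjointMap_apply, LinearIsometryEquiv.norm_map]
    exact (hp.norm_le _ hs).trans_eq (LinearIsometryEquiv.norm_map _ _)

theorem leftAlg_adjointSpace (T : Submodule ℂ (H →L[ℂ] K)) :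
    leftAlg (adjointSpace T) = rightAlg T := by
  refine congrArg closedSpan (Set.ext fun d => ⟨?_, ?_⟩)
  · rintro ⟨t, ht, s, hs, rfl⟩
    exact ⟨t†, ht, s†, hs, by rw [ContinuousLinearMap.adjoint_adjoint]⟩
  · rintro ⟨t, ht, s, hs, rfl⟩
    exact ⟨t†, adjoint_mem_adjointSpace ht, s†, adjoint_mem_adjointSpace hs, by
      rw [ContinuousLinearMap.adjoint_adjoint]⟩

/-- A contractive projection onto a sub-TRO is a right module map. -/
theorem IsContrProj.apply_comp_rightAlg {T X : Submodule ℂ (H →L[ℂ] K)}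
    {p : (H →L[ℂ] K) →ₗ[ℂ] (H →L[ℂ] K)} (hp : IsContrProj T X p) (hT : IsTRO T) (hX : IsTRO X)
    {d : H →L[ℂ] H} (hd : d ∈ rightAlg X) {t : H →L[ℂ] K} (ht : t ∈ T) :
    p (t ∘L d) = p t ∘L d := by
  have h1 : d† ∈ leftAlg (_root_.adjointSpace X) := by
    rw [leftAlg_adjointSpace]
    exact adjoint_mem_rightAlg hd
  have h2 := hp.adjointSpace.apply_leftAlg_comp hT.adjointSpace hX.adjointSpace h1
    (adjoint_mem_adjointSpace ht)
  rw [adjointMap_apply, adjointMap_apply, ← ContinuousLinearMap.adjoint_comp,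
    ContinuousLinearMap.adjoint_adjoint, ContinuousLinearMap.adjoint_adjoint,
    ← ContinuousLinearMap.adjoint_comp] at h2
  exact (ContinuousLinearMap.adjoint (𝕜 := ℂ) (E := H) (F := K)).injective h2

/-- `⟨T T*⟩ ⊆ ⟨T X*⟩` as soon as `T ⊆ ⟨X T* T⟩`. -/
theorem leftAlg_le_closedSpan {T X : Submodule ℂ (H →L[ℂ] K)} (hT : IsTRO T)
    (hd : T ≤ closedSpan {r | ∃ x ∈ X, ∃ s ∈ T, ∃ t ∈ T, r = x ∘L s† ∘L t}) :
    leftAlg T ≤ closedSpan {c | ∃ a ∈ T, ∃ x ∈ X, c = a ∘L x†} := by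
  refine Submodule.topologicalClosure_minimal _ (Submodule.span_le.2 ?_) (isClosed_closedSpan _)
  rintro _ ⟨t, ht, s, hs, rfl⟩
  refine map_closedSpan (closedSpan {c | ∃ a ∈ T, ∃ x ∈ X, c = a ∘L x†})
    (isClosed_closedSpan _) ((ContinuousLinearMap.compL ℂ K H K t).comp
    (ContinuousLinearMap.adjoint (𝕜 := ℂ) (E := H) (F := K)
      |>.toContinuousLinearEquiv.toContinuousLinearMap)) ?_ s (hd hs)
  rintro _ ⟨x, hx, s', hs', t', ht', rfl⟩
  refine subset_closedSpan ⟨t ∘L t'† ∘L s', hT.triple_mem t ht t' ht' s' hs', x, hx, ?_⟩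
  change t ∘L (x ∘L s'† ∘L t')† = _
  rw [ContinuousLinearMap.adjoint_comp, ContinuousLinearMap.adjoint_comp,
    ContinuousLinearMap.adjoint_adjoint]
  rfl

theorem adjointSpace_le_closedSpan {T X : Submodule ℂ (H →L[ℂ] K)}
    (hd : T ≤ closedSpan {r | ∃ s ∈ T, ∃ t ∈ T, ∃ x ∈ X, r = s ∘L t† ∘L x}) :
    adjointSpace T ≤ closedSpan {r | ∃ x ∈ adjointSpace X, ∃ s ∈ adjointSpace T,
      ∃ t ∈ adjointSpace T, r = x ∘L s† ∘L t} := by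
  intro s hs
  rw [← ContinuousLinearMap.adjoint_adjoint s]
  refine map_closedSpan (closedSpan {r | ∃ x ∈ adjointSpace X, ∃ s ∈ adjointSpace T,
      ∃ t ∈ adjointSpace T, r = x ∘L s† ∘L t})
    (isClosed_closedSpan _) (ContinuousLinearMap.adjoint (𝕜 := ℂ) (E := H) (F := K)
      |>.toContinuousLinearEquiv.toContinuousLinearMap) ?_ (s†) (hd hs)
  rintro _ ⟨r, hr, t, ht, x, hx, rfl⟩
  refine subset_closedSpan ⟨x†, adjoint_mem_adjointSpace hx, t†, adjoint_mem_adjointSpace ht,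
    r†, adjoint_mem_adjointSpace hr, ?_⟩
  change (r ∘L t† ∘L x)† = _
  rw [ContinuousLinearMap.adjoint_comp, ContinuousLinearMap.adjoint_comp]
  rfl

end Adjoint

/-! ### The maps on the corner algebras -/

/-- A functional relation that is a linear subspace, and is defined on all of `A`, is on `A` the
graph of a linear map. -/
theorem exists_linearMap_of_graph {E F : Type*} [AddCommGroup E] [Module ℂ E] [AddCommGroup F]
    [Module ℂ F] (A : Submodule ℂ E) (G : Submodule ℂ (E × F))
    (htotal : ∀ c ∈ A, ∃ b, (c, b) ∈ G) (huniq : ∀ b, ((0 : E), b) ∈ G → b = 0) :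
    ∃ f : E →ₗ[ℂ] F, ∀ c ∈ A, (c, f c) ∈ G := by
  have hu : ∀ {c b b'}, (c, b) ∈ G → (c, b') ∈ G → b = b' := fun {c b b'} h h' => by
    have h1 := sub_mem h h'
    rw [Prod.mk_sub_mk, sub_self] at h1
    exact sub_eq_zero.1 (huniq _ h1)
  choose f hf using htotal
  let g : A →ₗ[ℂ] F :=
    { toFun := fun c => f c c.2
      map_add' := fun c c' => hu (hf _ (c + c').2) (add_mem (hf _ c.2) (hf _ c'.2))
      map_smul' := fun z c => hu (hf _ (z • c).2) (G.smul_mem z (hf _ c.2)) }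
  obtain ⟨h, hh⟩ := g.exists_extend
  refine ⟨h, fun c hc => ?_⟩
  have h1 : h c = f c hc := congrArg (fun k : A →ₗ[ℂ] F => k ⟨c, hc⟩) hh
  rw [h1]
  exact hf c hc

/-- A linear map that preserves self-adjointness commutes with the star operation. -/
theorem apply_star_eq_star_apply {A : Type*} [AddCommGroup A] [StarAddMonoid A] [Module ℂ A]
    [StarModule ℂ A] (S : Submodule ℂ A) (hS : ∀ c ∈ S, star c ∈ S) (f : A →ₗ[ℂ] A)
    (hf : ∀ c ∈ S, IsSelfAdjoint c → IsSelfAdjoint (f c)) {c : A} (hc : c ∈ S) :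
    f (star c) = star (f c) := by
  -- Both `c + c*` and `i (c - c*)` are self-adjoint.
  have hI : Complex.I • (c - star c) ∈ S := S.smul_mem _ (sub_mem hc (hS c hc))
  have hIsa : IsSelfAdjoint (Complex.I • (c - star c)) := by
    rw [IsSelfAdjoint, star_smul, star_sub, star_star, Complex.star_def, Complex.conj_I,
      neg_smul, ← smul_neg, neg_sub]
  have h1 := (hf _ (add_mem hc (hS c hc)) (IsSelfAdjoint.add_star_self c)).star_eq
  have h2 := (hf _ hI hIsa).star_eq
  rw [map_smul, star_smul, Complex.star_def, Complex.conj_I, neg_smul, ← smul_neg] at h2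
  have h3 := (smul_right_injective A Complex.I_ne_zero) h2
  rw [map_add, star_add] at h1
  rw [map_sub, star_sub, neg_sub] at h3
  have h4 : (2 : ℂ) • f (star c) = (2 : ℂ) • star (f c) := by
    calc (2 : ℂ) • f (star c) = f c + f (star c) - (f c - f (star c)) := by module
      _ = star (f c) + star (f (star c)) - (star (f (star c)) - star (f c)) := by rw [h1, h3]
      _ = (2 : ℂ) • star (f c) := by module
  exact smul_right_injective A two_ne_zero h4

section Corner

variable {H K : Type*} [NormedAddCommGroup H] [InnerProductSpace ℂ H] [CompleteSpace H]
  [NormedAddCommGroup K] [InnerProductSpace ℂ K] [CompleteSpace K]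

/-- `⟨X X*⟩` acts isometrically on `X`. -/
theorem IsTRO.norm_leftAlg_le {X : Submodule ℂ (H →L[ℂ] K)} (hX : IsTRO X) {b : K →L[ℂ] K}
    (hb : b ∈ leftAlg X) {k : ℝ} (hk : 0 ≤ k) (h : ∀ y ∈ X, ‖b ∘L y‖ ≤ k * ‖y‖) : ‖b‖ ≤ k := by
  refine norm_le_of_forall_norm_comp_le (Y := (X : Set (H →L[ℂ] K))) hk
    (fun y hy => hX.leftAlg_comp hb hy)
    (fun y hy => hX.leftAlg_comp (adjoint_mem_leftAlg hb) hy) h (closedSpan_mono ?_ hb)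
  rintro _ ⟨t, ht, s, -, rfl⟩
  exact ⟨t, ht, s†, rfl⟩

theorem IsTRO.leftAlg_ext {X : Submodule ℂ (H →L[ℂ] K)} (hX : IsTRO X) {b b' : K →L[ℂ] K}
    (hb : b ∈ leftAlg X) (hb' : b' ∈ leftAlg X) (h : ∀ y ∈ X, b ∘L y = b' ∘L y) : b = b' := by
  refine sub_eq_zero.1 (norm_le_zero_iff.1
    (hX.norm_leftAlg_le (sub_mem hb hb') le_rfl fun y hy => ?_))
  rw [ContinuousLinearMap.sub_comp, h y hy, sub_self, norm_zero, zero_mul]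

/-- `⟨X X*⟩` as a star subalgebra of `B(K)`. -/
def IsTRO.leftStarAlg {X : Submodule ℂ (H →L[ℂ] K)} (hX : IsTRO X) :
    NonUnitalStarSubalgebra ℂ (K →L[ℂ] K) where
  carrier := leftAlg X
  zero_mem' := zero_mem _
  add_mem' := add_mem
  smul_mem' z _ h := Submodule.smul_mem _ z h
  mul_mem' ha hb := hX.leftAlg_mul ha hb
  star_mem' h := adjoint_mem_leftAlg h

/-- The map `Φ` restricts to the map `PP†` from `⟨T T*⟩` to `⟨X X*⟩`, here characterised by
`Φ(c) y = p(c y)` for `y ∈ X`. Applied to `T*`, `X*` and `P†` it describes `P†P`. -/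
structure IsCornerMap (T X : Submodule ℂ (H →L[ℂ] K)) (p : (H →L[ℂ] K) →ₗ[ℂ] (H →L[ℂ] K))
    (Φ : (K →L[ℂ] K) →ₗ[ℂ] (K →L[ℂ] K)) : Prop where
  mem : ∀ c ∈ leftAlg T, Φ c ∈ leftAlg X
  comp : ∀ c ∈ leftAlg T, ∀ y ∈ X, Φ c ∘L y = p (c ∘L y)

variable {T X : Submodule ℂ (H →L[ℂ] K)} {p : (H →L[ℂ] K) →ₗ[ℂ] (H →L[ℂ] K)}

theorem IsContrProj.norm_corner_le (hp : IsContrProj T X p) (hT : IsTRO T) (hX : IsTRO X)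
    {c b : K →L[ℂ] K} (hc : c ∈ leftAlg T) (hb : b ∈ leftAlg X)
    (h : ∀ y ∈ X, b ∘L y = p (c ∘L y)) : ‖b‖ ≤ ‖c‖ := by
  refine hX.norm_leftAlg_le hb (norm_nonneg c) fun y hy => ?_
  rw [h y hy]
  exact (hp.norm_le _ (hT.leftAlg_comp hc (hp.le hy))).trans
    (ContinuousLinearMap.opNorm_comp_le _ _)

/-- The relation `b y = p(c y)` for all `y ∈ X`, between `c ∈ ⟨T T*⟩` and `b ∈ ⟨X X*⟩`. -/
def cornerGraph (T X : Submodule ℂ (H →L[ℂ] K)) (p : (H →L[ℂ] K) →ₗ[ℂ] (H →L[ℂ] K)) :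
    Submodule ℂ ((K →L[ℂ] K) × (K →L[ℂ] K)) where
  carrier := {q | q.1 ∈ leftAlg T ∧ q.2 ∈ leftAlg X ∧ ∀ y ∈ X, q.2 ∘L y = p (q.1 ∘L y)}
  zero_mem' := ⟨zero_mem _, zero_mem _, fun y _ => by
    simp only [Prod.fst_zero, Prod.snd_zero, ContinuousLinearMap.zero_comp, map_zero]⟩
  add_mem' := fun {a b} ha hb => ⟨add_mem ha.1 hb.1, add_mem ha.2.1 hb.2.1, fun y hy => by
    rw [Prod.fst_add, Prod.snd_add, ContinuousLinearMap.add_comp, ContinuousLinearMap.add_comp,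
      map_add, ha.2.2 y hy, hb.2.2 y hy]⟩
  smul_mem' := fun z a ha => ⟨Submodule.smul_mem _ _ ha.1, Submodule.smul_mem _ _ ha.2.1,
    fun y hy => by
      rw [Prod.smul_fst, Prod.smul_snd, ContinuousLinearMap.smul_comp,
        ContinuousLinearMap.smul_comp, map_smul, ha.2.2 y hy]⟩

/-- The elements of `⟨T T*⟩` having an image under `PP†` form a closed set: the relation is
contractive, so images of a convergent sequence are Cauchy. -/
theorem IsContrProj.isClosed_domain_cornerGraph (hp : IsContrProj T X p) (hT : IsTRO T)
    (hX : IsTRO X) :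
    IsClosed ((cornerGraph T X p).map (LinearMap.fst ℂ _ _) : Set (K →L[ℂ] K)) := by
  rw [← isSeqClosed_iff_isClosed]
  intro c c₀ hc hlim
  have hc' : ∀ n, ∃ b, (c n, b) ∈ cornerGraph T X p := fun n => by
    obtain ⟨⟨q, b⟩, hq, rfl⟩ := hc n
    exact ⟨b, hq⟩
  choose b hb using hc'
  have hdist : ∀ m n, dist (b m) (b n) ≤ dist (c m) (c n) := fun m n => by
    have h := sub_mem (hb m) (hb n)
    rw [dist_eq_norm, dist_eq_norm]
    exact hp.norm_corner_le hT hX h.1 h.2.1 h.2.2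
  have hcauchy : CauchySeq b := by
    rw [Metric.cauchySeq_iff]
    intro ε hε
    obtain ⟨N, hN⟩ := Metric.cauchySeq_iff.1 hlim.cauchySeq ε hε
    exact ⟨N, fun m hm n hn => (hdist m n).trans_lt (hN m hm n hn)⟩
  obtain ⟨b₀, hb₀⟩ := cauchySeq_tendsto_of_complete hcauchy
  have hc₀T : c₀ ∈ leftAlg T :=
    (isClosed_closedSpan _).mem_of_tendsto hlim (.of_forall fun n => (hb n).1)
  refine ⟨(c₀, b₀), ⟨hc₀T,
    (isClosed_closedSpan _).mem_of_tendsto hb₀ (.of_forall fun n => (hb n).2.1),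
    fun y hy => ?_⟩, rfl⟩
  have h1 : Filter.Tendsto (fun n => b n ∘L y) Filter.atTop (nhds (b₀ ∘L y)) :=
    (((ContinuousLinearMap.compL ℂ H K K).flip y).continuous.tendsto b₀).comp hb₀
  refine tendsto_nhds_unique h1 ?_
  rw [tendsto_iff_norm_sub_tendsto_zero]
  have h2 : Filter.Tendsto (fun n => ‖c n - c₀‖ * ‖y‖) Filter.atTop (nhds 0) := by
    have := (tendsto_iff_norm_sub_tendsto_zero.1 hlim).mul_const ‖y‖
    rwa [zero_mul] at this
  refine squeeze_zero (fun _ => norm_nonneg _) (fun n => ?_) h2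
  rw [(hb n).2.2 y hy, ← map_sub, ← ContinuousLinearMap.sub_comp]
  exact (hp.norm_le _ (hT.leftAlg_comp (sub_mem (hb n).1 hc₀T) (hp.le hy))).trans
    (ContinuousLinearMap.opNorm_comp_le _ _)

theorem IsContrProj.exists_isCornerMap (hp : IsContrProj T X p) (hT : IsTRO T) (hX : IsTRO X)
    (hd : T ≤ closedSpan {r | ∃ x ∈ X, ∃ s ∈ T, ∃ t ∈ T, r = x ∘L s† ∘L t}) :
    ∃ Φ, IsCornerMap T X p Φ := by
  have htotal : leftAlg T ≤ (cornerGraph T X p).map (LinearMap.fst ℂ _ _) := by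
    refine (leftAlg_le_closedSpan hT hd).trans (Submodule.topologicalClosure_minimal _
      (Submodule.span_le.2 ?_) (hp.isClosed_domain_cornerGraph hT hX))
    rintro _ ⟨a, ha, x, hx, rfl⟩
    refine ⟨(a ∘L x†, p a ∘L x†), ⟨comp_adjoint_mem_leftAlg ha (hp.le hx),
      comp_adjoint_mem_leftAlg (hp.mem a ha) hx, fun y hy => ?_⟩, rfl⟩
    change p a ∘L (x† ∘L y) = p (a ∘L (x† ∘L y))
    rw [hp.apply_comp_rightAlg hT hX (adjoint_comp_mem_rightAlg hx hy) ha]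
  obtain ⟨Φ, hΦ⟩ := exists_linearMap_of_graph (leftAlg T) (cornerGraph T X p)
    (fun c hc => by
      obtain ⟨⟨q, b⟩, hq, rfl⟩ := htotal hc
      exact ⟨b, hq⟩)
    (fun b hb => norm_le_zero_iff.1
      ((hp.norm_corner_le hT hX hb.1 hb.2.1 hb.2.2).trans_eq norm_zero))
  exact ⟨Φ, fun c hc => (hΦ c hc).2.1, fun c hc => (hΦ c hc).2.2⟩

namespace IsCornerMap

variable {Φ : (K →L[ℂ] K) →ₗ[ℂ] (K →L[ℂ] K)}

theorem norm_le (hΦ : IsCornerMap T X p Φ) (hp : IsContrProj T X p) (hT : IsTRO T)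
    (hX : IsTRO X) {c : K →L[ℂ] K} (hc : c ∈ leftAlg T) : ‖Φ c‖ ≤ ‖c‖ :=
  hp.norm_corner_le hT hX hc (hΦ.mem c hc) (hΦ.comp c hc)

theorem fix (hΦ : IsCornerMap T X p Φ) (hp : IsContrProj T X p) (hX : IsTRO X)
    {c : K →L[ℂ] K} (hc : c ∈ leftAlg X) : Φ c = c := by
  have hcT := leftAlg_mono hp.le hc
  refine hX.leftAlg_ext (hΦ.mem c hcT) hc fun y hy => ?_
  rw [hΦ.comp c hcT y hy, hp.fix _ (hX.leftAlg_comp hc hy)]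

theorem map_comp_left (hΦ : IsCornerMap T X p Φ) (hp : IsContrProj T X p) (hT : IsTRO T)
    (hX : IsTRO X) {b c : K →L[ℂ] K} (hb : b ∈ leftAlg X) (hc : c ∈ leftAlg T) :
    Φ (b ∘L c) = b ∘L Φ c := by
  have hbc := hT.leftAlg_mul (leftAlg_mono hp.le hb) hc
  refine hX.leftAlg_ext (hΦ.mem _ hbc) (hX.leftAlg_mul hb (hΦ.mem c hc)) fun y hy => ?_
  rw [hΦ.comp _ hbc y hy, ContinuousLinearMap.comp_assoc, ContinuousLinearMap.comp_assoc,
    hΦ.comp c hc y hy, hp.apply_leftAlg_comp hT hX hb (hT.leftAlg_comp hc (hp.le hy))]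

theorem map_comp_right (hΦ : IsCornerMap T X p Φ) (hp : IsContrProj T X p) (hT : IsTRO T)
    (hX : IsTRO X) {b c : K →L[ℂ] K} (hb : b ∈ leftAlg X) (hc : c ∈ leftAlg T) :
    Φ (c ∘L b) = Φ c ∘L b := by
  have hcb := hT.leftAlg_mul hc (leftAlg_mono hp.le hb)
  refine hX.leftAlg_ext (hΦ.mem _ hcb) (hX.leftAlg_mul (hΦ.mem c hc) hb) fun y hy => ?_
  rw [hΦ.comp _ hcb y hy, ContinuousLinearMap.comp_assoc, ContinuousLinearMap.comp_assoc,
    hΦ.comp c hc _ (hX.leftAlg_comp hb hy)]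

theorem apply_comp_adjoint (hΦ : IsCornerMap T X p Φ) (hp : IsContrProj T X p) (hT : IsTRO T)
    (hX : IsTRO X) {a x : H →L[ℂ] K} (ha : a ∈ T) (hx : x ∈ X) :
    Φ (a ∘L x†) = p a ∘L x† := by
  have hc := comp_adjoint_mem_leftAlg ha (hp.le hx)
  refine hX.leftAlg_ext (hΦ.mem _ hc) (comp_adjoint_mem_leftAlg (hp.mem a ha) hx) fun y hy => ?_
  rw [hΦ.comp _ hc y hy, ContinuousLinearMap.comp_assoc, ContinuousLinearMap.comp_assoc,
    hp.apply_comp_rightAlg hT hX (adjoint_comp_mem_rightAlg hx hy) ha]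

theorem isCompressionDominated (hΦ : IsCornerMap T X p Φ) (hp : IsContrProj T X p)
    (hT : IsTRO T) (hX : IsTRO X) {c : K →L[ℂ] K} (hc : c ∈ leftAlg T) :
    IsCompressionDominated hX.leftStarAlg (Φ c) c := by
  intro u hu w
  have hu' : u ∈ leftAlg X := hu
  have huT := leftAlg_mono hp.le hu'
  have huu := hX.leftAlg_mul hu' hu'
  have h1 : Φ (u * c * u - w • (u * u)) = u * Φ c * u - w • (u * u) := by
    rw [map_sub, map_smul]
    congr 1
    · exact (hΦ.map_comp_right hp hT hX hu' (hT.leftAlg_mul huT hc)).trans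
        (congrArg (· ∘L u) (hΦ.map_comp_left hp hT hX hu' hc))
    · exact congrArg (w • ·) (hΦ.fix hp hX huu)
  rw [← h1]
  exact hΦ.norm_le hp hT hX (sub_mem (hT.leftAlg_mul (hT.leftAlg_mul huT hc) huT)
    (Submodule.smul_mem _ _ (hT.leftAlg_mul huT huT)))

theorem isPositive (hΦ : IsCornerMap T X p Φ) (hp : IsContrProj T X p) (hT : IsTRO T)
    (hX : IsTRO X) {c : K →L[ℂ] K} (hc : c ∈ leftAlg T) (hpos : c.IsPositive) :
    (Φ c).IsPositive :=
  (hΦ.isCompressionDominated hp hT hX hc).isPositive (isClosed_closedSpan _) (hΦ.mem c hc) hpos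

theorem map_adjoint (hΦ : IsCornerMap T X p Φ) (hp : IsContrProj T X p) (hT : IsTRO T)
    (hX : IsTRO X) {c : K →L[ℂ] K} (hc : c ∈ leftAlg T) : Φ (c†) = (Φ c)† :=
  apply_star_eq_star_apply (leftAlg T) (fun _ h => adjoint_mem_leftAlg h) Φ
    (fun c hc hsa => (hΦ.isCompressionDominated hp hT hX hc).isSelfAdjoint
      (isClosed_closedSpan _) (hΦ.mem c hc) hsa) hc

/-- The identity `PP†(x s*) = x P(s)*`, which rests on `PP†` preserving adjoints. -/
theorem apply_comp_adjoint_left (hΦ : IsCornerMap T X p Φ) (hp : IsContrProj T X p)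
    (hT : IsTRO T) (hX : IsTRO X) {x s : H →L[ℂ] K} (hx : x ∈ X) (hs : s ∈ T) :
    Φ (x ∘L s†) = x ∘L (p s)† := by
  have h1 := hΦ.map_adjoint hp hT hX (comp_adjoint_mem_leftAlg hs (hp.le hx))
  rwa [hΦ.apply_comp_adjoint hp hT hX hs hx, ContinuousLinearMap.adjoint_comp,
    ContinuousLinearMap.adjoint_comp, ContinuousLinearMap.adjoint_adjoint] at h1

end IsCornerMap

end Corner

/-! ### Two-by-two operator matrices -/

section BlockCalculus

variable {H K : Type*} [NormedAddCommGroup H] [InnerProductSpace ℂ H]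
  [NormedAddCommGroup K] [InnerProductSpace ℂ K]

/-- The `(1,1)` entry of an operator on `K ⊕ H`. -/
def entry₁₁ (m : WithLp 2 (K × H) →L[ℂ] WithLp 2 (K × H)) : K →L[ℂ] K :=
  ContinuousLinearMap.fst ℂ K H ∘L
    (WithLp.prodContinuousLinearEquiv 2 ℂ K H).toContinuousLinearMap ∘L m ∘L
    (WithLp.prodContinuousLinearEquiv 2 ℂ K H).symm.toContinuousLinearMap ∘L
    ContinuousLinearMap.inl ℂ K H

/-- The `(2,1)` entry of an operator on `K ⊕ H`. -/
def entry₂₁ (m : WithLp 2 (K × H) →L[ℂ] WithLp 2 (K × H)) : K →L[ℂ] H :=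
  ContinuousLinearMap.snd ℂ K H ∘L
    (WithLp.prodContinuousLinearEquiv 2 ℂ K H).toContinuousLinearMap ∘L m ∘L
    (WithLp.prodContinuousLinearEquiv 2 ℂ K H).symm.toContinuousLinearMap ∘L
    ContinuousLinearMap.inl ℂ K H

/-- The `(2,2)` entry of an operator on `K ⊕ H`. -/
def entry₂₂ (m : WithLp 2 (K × H) →L[ℂ] WithLp 2 (K × H)) : H →L[ℂ] H :=
  ContinuousLinearMap.snd ℂ K H ∘L
    (WithLp.prodContinuousLinearEquiv 2 ℂ K H).toContinuousLinearMap ∘L m ∘L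
    (WithLp.prodContinuousLinearEquiv 2 ℂ K H).symm.toContinuousLinearMap ∘L
    ContinuousLinearMap.inr ℂ K H

section

variable (a a' : K →L[ℂ] K) (b b' : H →L[ℂ] K) (c c' : K →L[ℂ] H) (d d' : H →L[ℂ] H)

theorem entry₁₁_blockOp : entry₁₁ (blockOp a b c d) = a := by
  ext v
  simp [entry₁₁]

theorem entry₂₁_blockOp : entry₂₁ (blockOp a b c d) = c := by
  ext v
  simp [entry₂₁]

theorem entry₂₂_blockOp : entry₂₂ (blockOp a b c d) = d := by
  ext v
  simp [entry₂₂]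

theorem blockOp_entries (m : WithLp 2 (K × H) →L[ℂ] WithLp 2 (K × H)) :
    blockOp (entry₁₁ m) (entry₁₂ m) (entry₂₁ m) (entry₂₂ m) = m := by
  refine ContinuousLinearMap.ext fun v => ?_
  have hv : v = WithLp.toLp 2 (v.fst, 0) + WithLp.toLp 2 (0, v.snd) := by
    refine WithLp.ofLp_injective 2 (Prod.ext ?_ ?_) <;> simp
  have hm : m v = m (WithLp.toLp 2 (v.fst, 0)) + m (WithLp.toLp 2 (0, v.snd)) := by
    rw [← map_add, ← hv]
  rw [hm]
  rfl

variable {a a' b b' c c' d d'}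

theorem blockOp_inj : blockOp a b c d = blockOp a' b' c' d' ↔
    a = a' ∧ b = b' ∧ c = c' ∧ d = d' := by
  refine ⟨fun h => ⟨?_, ?_, ?_, ?_⟩, by rintro ⟨rfl, rfl, rfl, rfl⟩; rfl⟩
  · simpa only [entry₁₁_blockOp] using congrArg entry₁₁ h
  · simpa only [entry₁₂_blockOp] using congrArg entry₁₂ h
  · simpa only [entry₂₁_blockOp] using congrArg entry₂₁ h
  · simpa only [entry₂₂_blockOp] using congrArg entry₂₂ h

theorem blockOp_add : blockOp a b c d + blockOp a' b' c' d' =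
    blockOp (a + a') (b + b') (c + c') (d + d') := by
  refine ContinuousLinearMap.ext fun v => WithLp.ofLp_injective 2 (Prod.ext ?_ ?_) <;>
    simp <;> abel

theorem blockOp_sub : blockOp a b c d - blockOp a' b' c' d' =
    blockOp (a - a') (b - b') (c - c') (d - d') := by
  refine ContinuousLinearMap.ext fun v => WithLp.ofLp_injective 2 (Prod.ext ?_ ?_) <;>
    simp <;> abel

theorem smul_blockOp (z : ℂ) : z • blockOp a b c d =
    blockOp (z • a) (z • b) (z • c) (z • d) := by
  refine ContinuousLinearMap.ext fun v => WithLp.ofLp_injective 2 (Prod.ext ?_ ?_) <;> simp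

theorem blockOp_zero : blockOp (0 : K →L[ℂ] K) (0 : H →L[ℂ] K) 0 0 = 0 := by
  refine ContinuousLinearMap.ext fun v => WithLp.ofLp_injective 2 (Prod.ext ?_ ?_) <;> simp

theorem norm_blockOp₁₁ : ‖blockOp a (0 : H →L[ℂ] K) 0 0‖ = ‖a‖ := by
  refine le_antisymm (ContinuousLinearMap.opNorm_le_bound _ (norm_nonneg a) fun v => ?_)
    (ContinuousLinearMap.opNorm_le_bound _ (norm_nonneg (blockOp a (0 : H →L[ℂ] K) 0 0)) fun v => ?_)
  · have h : blockOp a (0 : H →L[ℂ] K) 0 0 v = WithLp.toLp 2 (a v.fst, 0) := by simp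
    rw [h, WithLp.norm_toLp_fst]
    exact (a.le_opNorm _).trans
      (mul_le_mul_of_nonneg_left (WithLp.norm_fst_le (x := v)) (norm_nonneg a))
  · have h : blockOp a (0 : H →L[ℂ] K) 0 0 (WithLp.toLp 2 (v, 0)) =
        WithLp.toLp 2 (a v, 0) := by simp
    have h1 := (blockOp a (0 : H →L[ℂ] K) 0 0).le_opNorm (WithLp.toLp 2 (v, 0))
    rwa [h, WithLp.norm_toLp_fst, WithLp.norm_toLp_fst] at h1

theorem norm_blockOp₂₂ : ‖blockOp (0 : K →L[ℂ] K) 0 0 d‖ = ‖d‖ := by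
  refine le_antisymm (ContinuousLinearMap.opNorm_le_bound _ (norm_nonneg d) fun v => ?_)
    (ContinuousLinearMap.opNorm_le_bound _ (norm_nonneg (blockOp (0 : K →L[ℂ] K) 0 0 d)) fun v => ?_)
  · have h : blockOp (0 : K →L[ℂ] K) 0 0 d v = WithLp.toLp 2 (0, d v.snd) := by simp
    rw [h, WithLp.norm_toLp_snd]
    exact (d.le_opNorm _).trans
      (mul_le_mul_of_nonneg_left (WithLp.norm_snd_le (x := v)) (norm_nonneg d))
  · have h : blockOp (0 : K →L[ℂ] K) 0 0 d (WithLp.toLp 2 (0, v)) =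
        WithLp.toLp 2 (0, d v) := by simp
    have h1 := (blockOp (0 : K →L[ℂ] K) 0 0 d).le_opNorm (WithLp.toLp 2 (0, v))
    rwa [h, WithLp.norm_toLp_snd, WithLp.norm_toLp_snd] at h1

end

variable [CompleteSpace H] [CompleteSpace K] {a : K →L[ℂ] K} {d : H →L[ℂ] H}

theorem isPositive_blockOp₁₁ :
    (blockOp a (0 : H →L[ℂ] K) 0 0).IsPositive ↔ a.IsPositive := by
  constructor
  · intro h
    have hs : a† = a := by
      have h1 : star (blockOp a (0 : H →L[ℂ] K) 0 0) = _ := h.isSelfAdjoint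
      rw [star_blockOp, blockOp_inj] at h1
      exact h1.1
    refine ⟨ContinuousLinearMap.isSelfAdjoint_iff_isSymmetric.1 hs, fun v => ?_⟩
    have h2 := h.2 (WithLp.toLp 2 (v, 0))
    simpa [ContinuousLinearMap.reApplyInnerSelf_apply, WithLp.prod_inner_apply] using h2
  · intro h
    have hs : star (blockOp a (0 : H →L[ℂ] K) 0 0) = blockOp a 0 0 0 := by
      have h1 : a† = a := h.isSelfAdjoint
      rw [star_blockOp, h1, map_zero, map_zero, map_zero]
    refine ⟨ContinuousLinearMap.isSelfAdjoint_iff_isSymmetric.1 hs, fun v => ?_⟩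
    have h2 := h.2 v.fst
    simpa [ContinuousLinearMap.reApplyInnerSelf_apply, WithLp.prod_inner_apply] using h2

theorem isPositive_blockOp₂₂ :
    (blockOp (0 : K →L[ℂ] K) 0 0 d).IsPositive ↔ d.IsPositive := by
  constructor
  · intro h
    have hs : d† = d := by
      have h1 : star (blockOp (0 : K →L[ℂ] K) 0 0 d) = _ := h.isSelfAdjoint
      rw [star_blockOp, blockOp_inj] at h1
      exact h1.2.2.2
    refine ⟨ContinuousLinearMap.isSelfAdjoint_iff_isSymmetric.1 hs, fun v => ?_⟩
    have h2 := h.2 (WithLp.toLp 2 (0, v))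
    simpa [ContinuousLinearMap.reApplyInnerSelf_apply, WithLp.prod_inner_apply] using h2
  · intro h
    have hs : star (blockOp (0 : K →L[ℂ] K) 0 0 d) = blockOp 0 0 0 d := by
      have h1 : d† = d := h.isSelfAdjoint
      rw [star_blockOp, h1, map_zero, map_zero, map_zero]
    refine ⟨ContinuousLinearMap.isSelfAdjoint_iff_isSymmetric.1 hs, fun v => ?_⟩
    have h2 := h.2 v.snd
    simpa [ContinuousLinearMap.reApplyInnerSelf_apply, WithLp.prod_inner_apply] using h2

end BlockCalculus

section Star

variable {L : Type*} [NormedAddCommGroup L] [InnerProductSpace ℂ L] [CompleteSpace L]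

theorem star_sub_mul_sub_self (v w : L →L[ℂ] L) : star (v - w) * (v - w) =
    star v * v - star v * w - star w * v + star w * w := by
  rw [star_sub]
  noncomm_ring

theorem norm_le_norm_of_norm_star_mul_self_le {v w : L →L[ℂ] L}
    (h : ‖star w * w‖ ≤ ‖star v * v‖) : ‖w‖ ≤ ‖v‖ := by
  rw [CStarRing.norm_star_mul_self, CStarRing.norm_star_mul_self] at h
  exact abs_le_of_sq_le_sq' (by nlinarith) (norm_nonneg v) |>.2

theorem star_mul_eq_zero_of_star_mul_eq_zero {m e : L →L[ℂ] L} (h : star e * m = 0) :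
    star m * e = 0 := by
  have h1 := congrArg star h
  rwa [star_mul, star_star, star_zero] at h1

end Star

/-! ### The expectation on the linking algebra -/

section Linking

variable {H K : Type*} [NormedAddCommGroup H] [InnerProductSpace ℂ H] [CompleteSpace H]
  [NormedAddCommGroup K] [InnerProductSpace ℂ K] [CompleteSpace K]

theorem blockOp_mem_linkingAlgebra {T : Submodule ℂ (H →L[ℂ] K)} (hT : IsTRO T)
    {a : K →L[ℂ] K} {b : H →L[ℂ] K} {c : K →L[ℂ] H} {d : H →L[ℂ] H} :
    blockOp a b c d ∈ linkingAlgebra T hT ↔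
      a ∈ leftAlg T ∧ b ∈ T ∧ c ∈ adjointSpace T ∧ d ∈ leftAlg (adjointSpace T) := by
  rw [leftAlg_adjointSpace]
  constructor
  · rintro ⟨a', ha, t, ht, s, hs, d', hd, h⟩
    obtain ⟨rfl, rfl, rfl, rfl⟩ := blockOp_inj.1 h
    exact ⟨ha, ht, adjoint_mem_adjointSpace hs, hd⟩
  · rintro ⟨ha, hb, hc, hd⟩
    exact ⟨a, ha, b, hb, c†, hc, d, hd, by rw [ContinuousLinearMap.adjoint_adjoint]⟩

theorem isClosed_linkingAlgebra {T : Submodule ℂ (H →L[ℂ] K)} (hT : IsTRO T) :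
    IsClosed (linkingAlgebra T hT :
      Set (WithLp 2 (K × H) →L[ℂ] WithLp 2 (K × H))) := by
  have h : (linkingAlgebra T hT : Set (WithLp 2 (K × H) →L[ℂ] WithLp 2 (K × H))) =
      {m | entry₁₁ m ∈ leftAlg T} ∩ ({m | entry₁₂ m ∈ T} ∩
        ({m | entry₂₁ m ∈ adjointSpace T} ∩
          {m | entry₂₂ m ∈ leftAlg (adjointSpace T)})) := by
    ext m
    conv_lhs => rw [← blockOp_entries m]
    exact blockOp_mem_linkingAlgebra hT
  rw [h]
  refine ((isClosed_closedSpan _).preimage ?_).inter ((hT.isClosed.preimage ?_).inter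
    ((hT.adjointSpace.isClosed.preimage ?_).inter ((isClosed_closedSpan _).preimage ?_)))
  · unfold entry₁₁
    fun_prop
  · unfold entry₁₂
    fun_prop
  · unfold entry₂₁
    fun_prop
  · unfold entry₂₂
    fun_prop

theorem adjointSpace_adjointSpace (T : Submodule ℂ (H →L[ℂ] K)) :
    adjointSpace (adjointSpace T) = T := by
  ext t
  rw [mem_adjointSpace, mem_adjointSpace, ContinuousLinearMap.adjoint_adjoint]

theorem adjointMap_adjointMap (p : (H →L[ℂ] K) →ₗ[ℂ] (H →L[ℂ] K)) :
    adjointMap (adjointMap p) = p := by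
  refine LinearMap.ext fun t => ?_
  rw [adjointMap_apply, adjointMap_apply, ContinuousLinearMap.adjoint_adjoint,
    ContinuousLinearMap.adjoint_adjoint]

variable {T X : Submodule ℂ (H →L[ℂ] K)} {p : (H →L[ℂ] K) →ₗ[ℂ] (H →L[ℂ] K)}
  {Φ : (K →L[ℂ] K) →ₗ[ℂ] (K →L[ℂ] K)} {Ψ : (H →L[ℂ] H) →ₗ[ℂ] (H →L[ℂ] H)}

theorem IsCornerMap.comp_apply_right (hΦ : IsCornerMap T X p Φ) (hp : IsContrProj T X p)
    (hT : IsTRO T) (hX : IsTRO X) {c : K →L[ℂ] K} (hc : c ∈ leftAlg T) {σ : K →L[ℂ] H}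
    (hσ : σ ∈ adjointSpace X) : adjointMap p (σ ∘L c) = σ ∘L Φ c := by
  have h := hΦ.comp _ (adjoint_mem_leftAlg hc) _ hσ
  rw [hΦ.map_adjoint hp hT hX hc, ← ContinuousLinearMap.adjoint_comp,
    ← ContinuousLinearMap.adjoint_comp] at h
  rw [adjointMap_apply, ← h, ContinuousLinearMap.adjoint_adjoint]

/-- The right-handed characterisation `x (P†P)(d) = P(x d)` of `P†P`. -/
theorem IsCornerMap.apply_comp_of_adjointSpace
    (hΨ : IsCornerMap (adjointSpace T) (adjointSpace X) (adjointMap p) Ψ)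
    (hp : IsContrProj T X p) (hT : IsTRO T) (hX : IsTRO X) {d : H →L[ℂ] H}
    (hd : d ∈ leftAlg (adjointSpace T)) {x : H →L[ℂ] K} (hx : x ∈ X) :
    p (x ∘L d) = x ∘L Ψ d := by
  have hx' : x ∈ adjointSpace (adjointSpace X) := by rwa [adjointSpace_adjointSpace]
  have h := hΨ.comp_apply_right hp.adjointSpace hT.adjointSpace hX.adjointSpace hd hx'
  rwa [adjointMap_adjointMap] at h

/-- The entrywise map `(a b; c d) ↦ (Φ(a) p(b); p(c*)* Ψ(d))` on `B(K ⊕ H)`. -/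
def entrywiseMap (p : (H →L[ℂ] K) →ₗ[ℂ] (H →L[ℂ] K)) (Φ : (K →L[ℂ] K) →ₗ[ℂ] (K →L[ℂ] K))
    (Ψ : (H →L[ℂ] H) →ₗ[ℂ] (H →L[ℂ] H)) :
    (WithLp 2 (K × H) →L[ℂ] WithLp 2 (K × H)) →ₗ[ℂ]
      (WithLp 2 (K × H) →L[ℂ] WithLp 2 (K × H)) where
  toFun m := blockOp (Φ (entry₁₁ m)) (p (entry₁₂ m)) (adjointMap p (entry₂₁ m)) (Ψ (entry₂₂ m))
  map_add' m m' := by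
    obtain ⟨h1, h2, h3, h4⟩ := blockOp_inj.1 ((blockOp_entries (m + m')).trans
      ((congrArg₂ (· + ·) (blockOp_entries m) (blockOp_entries m')).symm.trans blockOp_add))
    rw [blockOp_add, ← map_add, ← map_add, ← map_add, ← map_add, ← h1, ← h2, ← h3, ← h4]
  map_smul' z m := by
    obtain ⟨h1, h2, h3, h4⟩ := blockOp_inj.1 ((blockOp_entries (z • m)).trans
      (by rw [← smul_blockOp, blockOp_entries m]))
    rw [RingHom.id_apply, smul_blockOp, ← map_smul, ← map_smul, ← map_smul, ← map_smul,
      ← h1, ← h2, ← h3, ← h4]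

theorem entrywiseMap_blockOp (a : K →L[ℂ] K) (b : H →L[ℂ] K) (c : K →L[ℂ] H)
    (d : H →L[ℂ] H) : entrywiseMap p Φ Ψ (blockOp a b c d) =
      blockOp (Φ a) (p b) (adjointMap p c) (Ψ d) := by
  change blockOp _ _ _ _ = _
  rw [entry₁₁_blockOp, entry₁₂_blockOp, entry₂₁_blockOp, entry₂₂_blockOp]

/-- A contractive projection `p` of the TRO `T` onto the sub-TRO `X`, with its corner maps `Φ`
(for `PP†`) and `Ψ` (for `P†P`). -/
structure IsExpectationData (T X : Submodule ℂ (H →L[ℂ] K))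
    (p : (H →L[ℂ] K) →ₗ[ℂ] (H →L[ℂ] K)) (Φ : (K →L[ℂ] K) →ₗ[ℂ] (K →L[ℂ] K))
    (Ψ : (H →L[ℂ] H) →ₗ[ℂ] (H →L[ℂ] H)) : Prop where
  hT : IsTRO T
  hX : IsTRO X
  hp : IsContrProj T X p
  hΦ : IsCornerMap T X p Φ
  hΨ : IsCornerMap (adjointSpace T) (adjointSpace X) (adjointMap p) Ψ

namespace IsExpectationData

variable (D : IsExpectationData T X p Φ Ψ)
include D

variable {m b v : WithLp 2 (K × H) →L[ℂ] WithLp 2 (K × H)}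

theorem mem (hm : m ∈ linkingAlgebra T D.hT) :
    entrywiseMap p Φ Ψ m ∈ linkingAlgebra X D.hX := by
  obtain ⟨hT, hX, hp, hΦ, hΨ⟩ := D
  rw [← blockOp_entries m] at hm ⊢
  obtain ⟨h1, h2, h3, h4⟩ := (blockOp_mem_linkingAlgebra hT).1 hm
  rw [entrywiseMap_blockOp]
  exact (blockOp_mem_linkingAlgebra hX).2
    ⟨hΦ.mem _ h1, hp.mem _ h2, hp.adjointSpace.mem _ h3, hΨ.mem _ h4⟩

theorem fix (hb : b ∈ linkingAlgebra X D.hX) : entrywiseMap p Φ Ψ b = b := by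
  obtain ⟨hT, hX, hp, hΦ, hΨ⟩ := D
  rw [← blockOp_entries b] at hb ⊢
  obtain ⟨h1, h2, h3, h4⟩ := (blockOp_mem_linkingAlgebra hX).1 hb
  rw [entrywiseMap_blockOp, hΦ.fix hp hX h1, hp.fix _ h2, hp.adjointSpace.fix _ h3,
    hΨ.fix hp.adjointSpace hX.adjointSpace h4]

theorem map_star (hm : m ∈ linkingAlgebra T D.hT) :
    entrywiseMap p Φ Ψ (star m) = star (entrywiseMap p Φ Ψ m) := by
  obtain ⟨hT, hX, hp, hΦ, hΨ⟩ := D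
  rw [← blockOp_entries m] at hm ⊢
  obtain ⟨h1, h2, h3, h4⟩ := (blockOp_mem_linkingAlgebra hT).1 hm
  rw [entrywiseMap_blockOp, star_blockOp, star_blockOp, entrywiseMap_blockOp,
    hΦ.map_adjoint hp hT hX h1,
    hΨ.map_adjoint hp.adjointSpace hT.adjointSpace hX.adjointSpace h4,
    adjointMap_apply, adjointMap_apply, ContinuousLinearMap.adjoint_adjoint,
    ContinuousLinearMap.adjoint_adjoint]

theorem map_mul_left (hb : b ∈ linkingAlgebra X D.hX) (hm : m ∈ linkingAlgebra T D.hT) :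
    entrywiseMap p Φ Ψ (b * m) = b * entrywiseMap p Φ Ψ m := by
  obtain ⟨hT, hX, hp, hΦ, hΨ⟩ := D
  rw [← blockOp_entries m] at hm ⊢
  rw [← blockOp_entries b] at hb ⊢
  obtain ⟨h1, h2, h3, h4⟩ := (blockOp_mem_linkingAlgebra hT).1 hm
  obtain ⟨k1, k2, k3, k4⟩ := (blockOp_mem_linkingAlgebra hX).1 hb
  have e1 : Φ (entry₁₂ b ∘L entry₂₁ m) = entry₁₂ b ∘L adjointMap p (entry₂₁ m) := by
    have := hΦ.apply_comp_adjoint_left hp hT hX k2 h3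
    rwa [ContinuousLinearMap.adjoint_adjoint] at this
  have e2 : Ψ (entry₂₁ b ∘L entry₁₂ m) = entry₂₁ b ∘L p (entry₁₂ m) := by
    have := hΨ.apply_comp_adjoint_left hp.adjointSpace hT.adjointSpace hX.adjointSpace k3
      (adjoint_mem_adjointSpace h2)
    rwa [adjointMap_apply, ContinuousLinearMap.adjoint_adjoint,
      ContinuousLinearMap.adjoint_adjoint] at this
  rw [entrywiseMap_blockOp, blockOp_mul, blockOp_mul, entrywiseMap_blockOp]
  simp only [map_add]
  rw [hΦ.map_comp_left hp hT hX k1 h1, e1, hp.apply_leftAlg_comp hT hX k1 h2,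
    hΨ.apply_comp_of_adjointSpace hp hT hX h4 k2, hΦ.comp_apply_right hp hT hX h1 k3,
    hp.adjointSpace.apply_leftAlg_comp hT.adjointSpace hX.adjointSpace k4 h3, e2,
    hΨ.map_comp_left hp.adjointSpace hT.adjointSpace hX.adjointSpace k4 h4]

theorem map_mul_right (hb : b ∈ linkingAlgebra X D.hX) (hm : m ∈ linkingAlgebra T D.hT) :
    entrywiseMap p Φ Ψ (m * b) = entrywiseMap p Φ Ψ m * b := by
  have hbT := linkingAlgebra_mono D.hX D.hT D.hp.le hb
  have h := D.map_mul_left (star_mem hb) (star_mem hm)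
  rw [← star_mul, D.map_star (mul_mem hm hbT), D.map_star hm, ← star_mul] at h
  exact star_injective h

end IsExpectationData

/-- An operator on `K ⊕ H` with a single nonzero column. -/
def IsColumn (v : WithLp 2 (K × H) →L[ℂ] WithLp 2 (K × H)) : Prop :=
  (∃ (a : K →L[ℂ] K) (c : K →L[ℂ] H), v = blockOp a 0 c 0) ∨
    ∃ (b : H →L[ℂ] K) (d : H →L[ℂ] H), v = blockOp 0 b 0 d

/-- An operator on `K ⊕ H` supported in one of the diagonal corners. -/
def IsDiagonalCorner (v : WithLp 2 (K × H) →L[ℂ] WithLp 2 (K × H)) : Prop :=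
  (∃ a : K →L[ℂ] K, v = blockOp a 0 0 0) ∨ ∃ d : H →L[ℂ] H, v = blockOp 0 0 0 d

theorem IsColumn.mul_left {v : WithLp 2 (K × H) →L[ℂ] WithLp 2 (K × H)} (hv : IsColumn v)
    (m : WithLp 2 (K × H) →L[ℂ] WithLp 2 (K × H)) : IsColumn (m * v) := by
  rw [← blockOp_entries m]
  rcases hv with ⟨a, c, rfl⟩ | ⟨b, d, rfl⟩
  · refine Or.inl ⟨_, _, (blockOp_mul ..).trans (blockOp_inj.2 ⟨rfl, ?_, rfl, ?_⟩)⟩ <;> simp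
  · refine Or.inr ⟨_, _, (blockOp_mul ..).trans (blockOp_inj.2 ⟨?_, rfl, ?_, rfl⟩)⟩ <;> simp

theorem IsColumn.isDiagonalCorner_star_mul_self {v : WithLp 2 (K × H) →L[ℂ] WithLp 2 (K × H)}
    (hv : IsColumn v) : IsDiagonalCorner (star v * v) := by
  rcases hv with ⟨a, c, rfl⟩ | ⟨b, d, rfl⟩
  · rw [star_blockOp, blockOp_mul]
    refine Or.inl ⟨_, blockOp_inj.2 ⟨rfl, ?_, ?_, ?_⟩⟩ <;> simp
  · rw [star_blockOp, blockOp_mul]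
    refine Or.inr ⟨_, blockOp_inj.2 ⟨?_, ?_, ?_, rfl⟩⟩ <;> simp

theorem IsColumn.sub_entrywiseMap {v : WithLp 2 (K × H) →L[ℂ] WithLp 2 (K × H)}
    (hv : IsColumn v) : IsColumn (v - entrywiseMap p Φ Ψ v) := by
  rcases hv with ⟨a, c, rfl⟩ | ⟨b, d, rfl⟩
  · rw [entrywiseMap_blockOp, blockOp_sub]
    refine Or.inl ⟨_, _, blockOp_inj.2 ⟨rfl, ?_, rfl, ?_⟩⟩ <;> simp
  · rw [entrywiseMap_blockOp, blockOp_sub]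
    refine Or.inr ⟨_, _, blockOp_inj.2 ⟨?_, rfl, ?_, rfl⟩⟩ <;> simp

namespace IsExpectationData

variable (D : IsExpectationData T X p Φ Ψ)
include D

variable {m b v : WithLp 2 (K × H) →L[ℂ] WithLp 2 (K × H)}

theorem isPositive_of_isDiagonalCorner (hm : m ∈ linkingAlgebra T D.hT) (hc : IsDiagonalCorner m)
    (hpos : m.IsPositive) : (entrywiseMap p Φ Ψ m).IsPositive := by
  obtain ⟨hT, hX, hp, hΦ, hΨ⟩ := D
  rcases hc with ⟨a, rfl⟩ | ⟨d, rfl⟩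
  · rw [entrywiseMap_blockOp, map_zero, map_zero, map_zero, isPositive_blockOp₁₁]
    exact hΦ.isPositive hp hT hX ((blockOp_mem_linkingAlgebra hT).1 hm).1
      (isPositive_blockOp₁₁.1 hpos)
  · rw [entrywiseMap_blockOp, map_zero, map_zero, map_zero, isPositive_blockOp₂₂]
    exact hΨ.isPositive hp.adjointSpace hT.adjointSpace hX.adjointSpace
      ((blockOp_mem_linkingAlgebra hT).1 hm).2.2.2 (isPositive_blockOp₂₂.1 hpos)

theorem norm_le_of_isDiagonalCorner (hm : m ∈ linkingAlgebra T D.hT) (hc : IsDiagonalCorner m) :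
    ‖entrywiseMap p Φ Ψ m‖ ≤ ‖m‖ := by
  obtain ⟨hT, hX, hp, hΦ, hΨ⟩ := D
  rcases hc with ⟨a, rfl⟩ | ⟨d, rfl⟩
  · rw [entrywiseMap_blockOp, map_zero, map_zero, map_zero, norm_blockOp₁₁, norm_blockOp₁₁]
    exact hΦ.norm_le hp hT hX ((blockOp_mem_linkingAlgebra hT).1 hm).1
  · rw [entrywiseMap_blockOp, map_zero, map_zero, map_zero, norm_blockOp₂₂, norm_blockOp₂₂]
    exact hΨ.norm_le hp.adjointSpace hT.adjointSpace hX.adjointSpace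
      ((blockOp_mem_linkingAlgebra hT).1 hm).2.2.2

/-- The Kadison–Schwarz inequality `E(v)* E(v) ≤ E(v* v)` for a single column `v`, for which
`v* v` lies in a corner, where `E` is already known to be positive and contractive. -/
theorem norm_le_of_isColumn (hv : v ∈ linkingAlgebra T D.hT) (hc : IsColumn v) :
    ‖entrywiseMap p Φ Ψ v‖ ≤ ‖v‖ := by
  set w := entrywiseMap p Φ Ψ v with hw
  have hwX : w ∈ linkingAlgebra X D.hX := D.mem hv
  have hwT := linkingAlgebra_mono D.hX D.hT D.hp.le hwX
  have hvs := star_mem hv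
  have hpos : (entrywiseMap p Φ Ψ (star (v - w) * (v - w))).IsPositive :=
    D.isPositive_of_isDiagonalCorner (mul_mem (star_mem (sub_mem hv hwT)) (sub_mem hv hwT))
      hc.sub_entrywiseMap.isDiagonalCorner_star_mul_self
      ((ContinuousLinearMap.nonneg_iff_isPositive _).1 (star_mul_self_nonneg _))
  have hexp : entrywiseMap p Φ Ψ (star (v - w) * (v - w)) =
      entrywiseMap p Φ Ψ (star v * v) - star w * w := by
    rw [star_sub_mul_sub_self, map_add, map_sub, map_sub, D.map_mul_right hwX hvs, D.map_star hv,
      D.map_mul_left (star_mem hwX) hv, D.fix (mul_mem (star_mem hwX) hwX)]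
    abel
  rw [hexp] at hpos
  have hle : star w * w ≤ entrywiseMap p Φ Ψ (star v * v) :=
    sub_nonneg.1 ((ContinuousLinearMap.nonneg_iff_isPositive _).2 hpos)
  have h1 : ‖star w * w‖ ≤ ‖star v * v‖ :=
    (CStarAlgebra.norm_le_norm_of_nonneg_of_le (star_mul_self_nonneg w) hle).trans
      (D.norm_le_of_isDiagonalCorner (mul_mem hvs hv) hc.isDiagonalCorner_star_mul_self)
  exact norm_le_norm_of_norm_star_mul_self_le h1

theorem norm_le (hm : m ∈ linkingAlgebra T D.hT) : ‖entrywiseMap p Φ Ψ m‖ ≤ ‖m‖ := by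
  have hmX := D.mem hm
  set Y : Set (WithLp 2 (K × H) →L[ℂ] WithLp 2 (K × H)) :=
    {y | y ∈ linkingAlgebra X D.hX ∧ IsColumn y} with hY
  refine norm_le_of_forall_norm_comp_le (Y := Y) (norm_nonneg m)
    (fun y hy => ⟨mul_mem hmX hy.1, hy.2.mul_left _⟩)
    (fun y hy => ⟨mul_mem (star_mem hmX) hy.1, hy.2.mul_left (star (entrywiseMap p Φ Ψ m))⟩)
    (fun y hy => ?_) ?_
  · have h1 := D.map_mul_right hy.1 hm
    have hyT := linkingAlgebra_mono D.hX D.hT D.hp.le hy.1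
    change ‖entrywiseMap p Φ Ψ m * y‖ ≤ _
    rw [← h1]
    exact (D.norm_le_of_isColumn (mul_mem hm hyT) (hy.2.mul_left m)).trans (norm_mul_le _ _)
  · -- An element of the linking algebra is the sum of its two columns.
    set w := entrywiseMap p Φ Ψ m with hw
    have hwX := hmX
    rw [← blockOp_entries w] at hwX ⊢
    obtain ⟨h1, h2, h3, h4⟩ := (blockOp_mem_linkingAlgebra D.hX).1 hwX
    have hsum : blockOp (entry₁₁ w) (entry₁₂ w) (entry₂₁ w) (entry₂₂ w) =
        blockOp (entry₁₁ w) 0 (entry₂₁ w) 0 + blockOp 0 (entry₁₂ w) 0 (entry₂₂ w) := by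
      rw [blockOp_add, add_zero, add_zero, zero_add, zero_add]
    rw [hsum]
    refine add_mem (subset_closedSpan ⟨_, ⟨?_, Or.inl ⟨_, _, rfl⟩⟩, 1, rfl⟩)
      (subset_closedSpan ⟨_, ⟨?_, Or.inr ⟨_, _, rfl⟩⟩, 1, rfl⟩)
    · exact (blockOp_mem_linkingAlgebra D.hX).2 ⟨h1, zero_mem _, h3, zero_mem _⟩
    · exact (blockOp_mem_linkingAlgebra D.hX).2 ⟨zero_mem _, h2, zero_mem _, h4⟩

theorem isPositive (hm : m ∈ linkingAlgebra T D.hT) (hpos : m.IsPositive) :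
    (entrywiseMap p Φ Ψ m).IsPositive := by
  have hdom : IsCompressionDominated (linkingAlgebra X D.hX) (entrywiseMap p Φ Ψ m) m := by
    intro u hu w
    have huT := linkingAlgebra_mono D.hX D.hT D.hp.le hu
    have h1 : entrywiseMap p Φ Ψ (u * m * u - w • (u * u)) =
        u * entrywiseMap p Φ Ψ m * u - w • (u * u) := by
      rw [map_sub, map_smul, D.map_mul_right hu (mul_mem huT hm), D.map_mul_left hu hm,
        D.fix (mul_mem hu hu)]
    rw [← h1]
    exact D.norm_le (sub_mem (mul_mem (mul_mem huT hm) huT)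
      (SMulMemClass.smul_mem w (mul_mem huT huT)))
  exact hdom.isPositive (isClosed_linkingAlgebra D.hX) (D.mem hm) hpos

end IsExpectationData

end Linking

/-! ### Uniqueness -/

section Extension

variable {L : Type*} [NormedAddCommGroup L] [InnerProductSpace ℂ L] [CompleteSpace L]

/-- A conditional expectation, extended to a linear map on all bounded operators in order to
dispense with subtypes. -/
theorem IsConditionalExpectation.exists_extension {A B : NonUnitalStarSubalgebra ℂ (L →L[ℂ] L)}
    {hBA : B ≤ A} {E : A →ₗ[ℂ] B} (hE : IsConditionalExpectation hBA E) :
    ∃ F : (L →L[ℂ] L) →ₗ[ℂ] (L →L[ℂ] L), (∀ m (hm : m ∈ A), F m = E ⟨m, hm⟩) ∧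
      (∀ m ∈ A, F m ∈ B) ∧
      (∀ b ∈ B, ∀ m ∈ A, F (b * m) = b * F m) ∧ ∀ b ∈ B, ∀ m ∈ A, F (m * b) = F m * b := by
  let S : Submodule ℂ (L →L[ℂ] L) := A.toNonUnitalSubalgebra.toSubmodule
  let f : S →ₗ[ℂ] (L →L[ℂ] L) :=
    { toFun := fun m => E ⟨m, m.2⟩
      map_add' := fun m m' => congrArg Subtype.val (E.map_add' ⟨m, m.2⟩ ⟨m', m'.2⟩)
      map_smul' := fun z m => congrArg Subtype.val (E.map_smul' z ⟨m, m.2⟩) }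
  obtain ⟨F, hF⟩ := f.exists_extend
  have hF' : ∀ (m) (hm : m ∈ A), F m = E ⟨m, hm⟩ := fun m hm =>
    congrArg (fun g : S →ₗ[ℂ] (L →L[ℂ] L) => g ⟨m, hm⟩) hF
  refine ⟨F, hF', fun m hm => ?_, fun b hb m hm => ?_, fun b hb m hm => ?_⟩
  · rw [hF' m hm]
    exact (E ⟨m, hm⟩).2
  · rw [hF' _ (mul_mem (hBA hb) hm), hF' m hm]
    exact congrArg Subtype.val (hE.mul_left ⟨b, hb⟩ ⟨m, hm⟩)
  · rw [hF' _ (mul_mem hm (hBA hb)), hF' m hm]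
    exact congrArg Subtype.val (hE.mul_right ⟨m, hm⟩ ⟨b, hb⟩)

/-- The restriction of a linear map on bounded operators to a map between subalgebras. -/
def restrictSubalgebra {A B : NonUnitalStarSubalgebra ℂ (L →L[ℂ] L)}
    (F : (L →L[ℂ] L) →ₗ[ℂ] (L →L[ℂ] L)) (h : ∀ m ∈ A, F m ∈ B) : A →ₗ[ℂ] B where
  toFun m := ⟨F m, h m m.2⟩
  map_add' m m' := Subtype.ext (F.map_add m m')
  map_smul' z m := Subtype.ext (F.map_smul z m)

theorem isConditionalExpectation_restrictSubalgebra
    {A B : NonUnitalStarSubalgebra ℂ (L →L[ℂ] L)} (hBA : B ≤ A)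
    {F : (L →L[ℂ] L) →ₗ[ℂ] (L →L[ℂ] L)} (h : ∀ m ∈ A, F m ∈ B) (hnorm : ∀ m ∈ A, ‖F m‖ ≤ ‖m‖)
    (hfix : ∀ b ∈ B, F b = b) (hpos : ∀ m ∈ A, m.IsPositive → (F m).IsPositive)
    (hl : ∀ b ∈ B, ∀ m ∈ A, F (b * m) = b * F m)
    (hr : ∀ b ∈ B, ∀ m ∈ A, F (m * b) = F m * b) :
    IsConditionalExpectation hBA (restrictSubalgebra F h) where
  contractive m := hnorm m m.2
  apply_of_mem b := Subtype.ext (hfix b b.2)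
  positive m := hpos m m.2
  mul_left b m := Subtype.ext (hl b b.2 m m.2)
  mul_right m b := Subtype.ext (hr b b.2 m m.2)

theorem eq_restrictSubalgebra {A B : NonUnitalStarSubalgebra ℂ (L →L[ℂ] L)} {E : A →ₗ[ℂ] B}
    {F G : (L →L[ℂ] L) →ₗ[ℂ] (L →L[ℂ] L)} (h : ∀ m ∈ A, F m ∈ B)
    (hE : ∀ m (hm : m ∈ A), G m = E ⟨m, hm⟩) (hGF : ∀ m ∈ A, G m = F m) :
    E = restrictSubalgebra F h :=
  LinearMap.ext fun m => Subtype.ext ((hE m m.2).symm.trans (hGF m m.2))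

end Extension

section Uniqueness

variable {H K : Type*} [NormedAddCommGroup H] [InnerProductSpace ℂ H] [CompleteSpace H]
  [NormedAddCommGroup K] [InnerProductSpace ℂ K] [CompleteSpace K]

theorem eq_zero_of_comp_adjoint_eq_zero {t : H →L[ℂ] K} (h : t ∘L t† = 0) : t = 0 := by
  have h1 := ContinuousLinearMap.norm_adjoint_comp_self (t†)
  rw [ContinuousLinearMap.adjoint_adjoint, h, norm_zero, LinearIsometryEquiv.norm_map] at h1
  exact norm_eq_zero.1 (mul_self_eq_zero.1 h1.symm)

theorem eq_zero_of_comp_adjoint_comp_eq_zero {t : H →L[ℂ] K} (h : t ∘L (t† ∘L t) = 0) :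
    t = 0 := by
  have h1 : (t† ∘L t) ∘L (t† ∘L t)† = 0 := by
    rw [ContinuousLinearMap.adjoint_comp, ContinuousLinearMap.adjoint_adjoint,
      ContinuousLinearMap.comp_assoc, h, ContinuousLinearMap.comp_zero]
  have h2 : (t†) ∘L (t†)† = 0 := by
    rw [ContinuousLinearMap.adjoint_adjoint]
    exact eq_zero_of_comp_adjoint_eq_zero h1
  have h3 := eq_zero_of_comp_adjoint_eq_zero h2
  rw [← ContinuousLinearMap.adjoint_adjoint t, h3, map_zero]

variable {T X : Submodule ℂ (H →L[ℂ] K)} {p : (H →L[ℂ] K) →ₗ[ℂ] (H →L[ℂ] K)}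
  {Φ : (K →L[ℂ] K) →ₗ[ℂ] (K →L[ℂ] K)} {Ψ : (H →L[ℂ] H) →ₗ[ℂ] (H →L[ℂ] H)}

/-- An element of `A_X` whose product with the corner `⟨X X*⟩` vanishes has zero first column. -/
theorem column₁_eq_zero (hX : IsTRO X) {a : K →L[ℂ] K} {b : H →L[ℂ] K} {c : K →L[ℂ] H}
    {d : H →L[ℂ] H} (hm : blockOp a b c d ∈ linkingAlgebra X hX)
    (h : ∀ e ∈ leftAlg X, blockOp a b c d * blockOp e 0 0 0 = 0) : a = 0 ∧ c = 0 := by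
  obtain ⟨h1, -, h3, -⟩ := (blockOp_mem_linkingAlgebra hX).1 hm
  have key : ∀ e ∈ leftAlg X, a ∘L e = 0 ∧ c ∘L e = 0 := fun e he => by
    have h4 := h e he
    rw [blockOp_mul, ← blockOp_zero, blockOp_inj] at h4
    simp only [ContinuousLinearMap.comp_zero, add_zero] at h4
    exact ⟨h4.1, h4.2.2.1⟩
  refine ⟨eq_zero_of_comp_adjoint_eq_zero (key _ (adjoint_mem_leftAlg h1)).1,
    eq_zero_of_comp_adjoint_comp_eq_zero (key _ ?_).2⟩
  have h5 := comp_adjoint_mem_leftAlg (T := X) h3 h3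
  rwa [ContinuousLinearMap.adjoint_adjoint] at h5

theorem column₂_eq_zero (hX : IsTRO X) {a : K →L[ℂ] K} {b : H →L[ℂ] K} {c : K →L[ℂ] H}
    {d : H →L[ℂ] H} (hm : blockOp a b c d ∈ linkingAlgebra X hX)
    (h : ∀ e ∈ leftAlg (adjointSpace X), blockOp a b c d * blockOp 0 0 0 e = 0) :
    b = 0 ∧ d = 0 := by
  obtain ⟨-, h2, -, h4⟩ := (blockOp_mem_linkingAlgebra hX).1 hm
  have key : ∀ e ∈ leftAlg (adjointSpace X), b ∘L e = 0 ∧ d ∘L e = 0 := fun e he => by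
    have h5 := h e he
    rw [blockOp_mul, ← blockOp_zero, blockOp_inj] at h5
    simp only [ContinuousLinearMap.comp_zero, zero_add] at h5
    exact ⟨h5.2.1, h5.2.2.2⟩
  refine ⟨eq_zero_of_comp_adjoint_comp_eq_zero (key _ ?_).1,
    eq_zero_of_comp_adjoint_eq_zero (key _ (adjoint_mem_leftAlg h4)).2⟩
  rw [leftAlg_adjointSpace]
  exact adjoint_comp_mem_rightAlg h2 h2

theorem row₁_eq_zero (hX : IsTRO X) {a : K →L[ℂ] K} {b : H →L[ℂ] K} {c : K →L[ℂ] H}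
    {d : H →L[ℂ] H} (hm : blockOp a b c d ∈ linkingAlgebra X hX)
    (h : ∀ e ∈ leftAlg X, blockOp e 0 0 0 * blockOp a b c d = 0) : a = 0 ∧ b = 0 := by
  have hs := star_mem hm
  rw [star_blockOp] at hs
  have h1 := column₁_eq_zero hX hs fun e he => by
    rw [← star_blockOp]
    refine star_mul_eq_zero_of_star_mul_eq_zero ?_
    rw [star_blockOp, map_zero, map_zero, map_zero]
    exact h _ (adjoint_mem_leftAlg he)
  exact ⟨(LinearIsometryEquiv.map_eq_zero_iff _).1 h1.1,
    (LinearIsometryEquiv.map_eq_zero_iff _).1 h1.2⟩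

theorem row₂_eq_zero (hX : IsTRO X) {a : K →L[ℂ] K} {b : H →L[ℂ] K} {c : K →L[ℂ] H}
    {d : H →L[ℂ] H} (hm : blockOp a b c d ∈ linkingAlgebra X hX)
    (h : ∀ e ∈ leftAlg (adjointSpace X), blockOp 0 0 0 e * blockOp a b c d = 0) :
    c = 0 ∧ d = 0 := by
  have hs := star_mem hm
  rw [star_blockOp] at hs
  have h1 := column₂_eq_zero hX hs fun e he => by
    rw [← star_blockOp]
    refine star_mul_eq_zero_of_star_mul_eq_zero ?_
    rw [star_blockOp, map_zero, map_zero, map_zero]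
    exact h _ (adjoint_mem_leftAlg he)
  exact ⟨(LinearIsometryEquiv.map_eq_zero_iff _).1 h1.1,
    (LinearIsometryEquiv.map_eq_zero_iff _).1 h1.2⟩

/-- An `A_X`-bimodule map `F` from `A_T` to `A_X` with `(1,2)` corner `p` is the entrywise map:
multiplying by the corners of `A_X` shows that `F` respects the four corners, and multiplying by
`X` in the `(1,2)` corner then determines each of them. -/
theorem IsExpectationData.eq_entrywiseMap (D : IsExpectationData T X p Φ Ψ)
    (F : (WithLp 2 (K × H) →L[ℂ] WithLp 2 (K × H)) →ₗ[ℂ]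
      (WithLp 2 (K × H) →L[ℂ] WithLp 2 (K × H)))
    (hmem : ∀ m ∈ linkingAlgebra T D.hT, F m ∈ linkingAlgebra X D.hX)
    (hl : ∀ b ∈ linkingAlgebra X D.hX, ∀ m ∈ linkingAlgebra T D.hT, F (b * m) = b * F m)
    (hr : ∀ b ∈ linkingAlgebra X D.hX, ∀ m ∈ linkingAlgebra T D.hT, F (m * b) = F m * b)
    (h₁₂ : ∀ t ∈ T, entry₁₂ (F (blockOp 0 t 0 0)) = p t)
    {m : WithLp 2 (K × H) →L[ℂ] WithLp 2 (K × H)} (hm : m ∈ linkingAlgebra T D.hT) :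
    F m = entrywiseMap p Φ Ψ m := by
  obtain ⟨hT, hX, hp, hΦ, hΨ⟩ := D
  have m11 : ∀ e ∈ leftAlg X, blockOp e (0 : H →L[ℂ] K) 0 0 ∈ linkingAlgebra X hX :=
    fun e he => (blockOp_mem_linkingAlgebra hX).2 ⟨he, zero_mem _, zero_mem _, zero_mem _⟩
  have m12 : ∀ y ∈ X, blockOp (0 : K →L[ℂ] K) y 0 0 ∈ linkingAlgebra X hX :=
    fun e he => (blockOp_mem_linkingAlgebra hX).2 ⟨zero_mem _, he, zero_mem _, zero_mem _⟩
  have m22 : ∀ e ∈ leftAlg (adjointSpace X),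
      blockOp (0 : K →L[ℂ] K) 0 0 e ∈ linkingAlgebra X hX :=
    fun e he => (blockOp_mem_linkingAlgebra hX).2 ⟨zero_mem _, zero_mem _, zero_mem _, he⟩
  -- Products of corners that vanish give vanishing columns and rows of `F m`.
  have c1 : ∀ m ∈ linkingAlgebra T hT, (∀ e : K →L[ℂ] K, m * blockOp e 0 0 0 = 0) →
      entry₁₁ (F m) = 0 ∧ entry₂₁ (F m) = 0 := fun m hm h => by
    have hF := hmem m hm
    rw [← blockOp_entries (F m)] at hF
    refine column₁_eq_zero hX hF fun e he => ?_
    rw [blockOp_entries, ← hr _ (m11 e he) m hm, h, map_zero]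
  have c2 : ∀ m ∈ linkingAlgebra T hT, (∀ e : H →L[ℂ] H, m * blockOp 0 0 0 e = 0) →
      entry₁₂ (F m) = 0 ∧ entry₂₂ (F m) = 0 := fun m hm h => by
    have hF := hmem m hm
    rw [← blockOp_entries (F m)] at hF
    refine column₂_eq_zero hX hF fun e he => ?_
    rw [blockOp_entries, ← hr _ (m22 e he) m hm, h, map_zero]
  have r1 : ∀ m ∈ linkingAlgebra T hT, (∀ e : K →L[ℂ] K, blockOp e 0 0 0 * m = 0) →
      entry₁₁ (F m) = 0 ∧ entry₁₂ (F m) = 0 := fun m hm h => by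
    have hF := hmem m hm
    rw [← blockOp_entries (F m)] at hF
    refine row₁_eq_zero hX hF fun e he => ?_
    rw [blockOp_entries, ← hl _ (m11 e he) m hm, h, map_zero]
  have r2 : ∀ m ∈ linkingAlgebra T hT, (∀ e : H →L[ℂ] H, blockOp 0 0 0 e * m = 0) →
      entry₂₁ (F m) = 0 ∧ entry₂₂ (F m) = 0 := fun m hm h => by
    have hF := hmem m hm
    rw [← blockOp_entries (F m)] at hF
    refine row₂_eq_zero hX hF fun e he => ?_
    rw [blockOp_entries, ← hl _ (m22 e he) m hm, h, map_zero]
  have f12 : ∀ t ∈ T, F (blockOp 0 t 0 0) = blockOp 0 (p t) 0 0 := fun t ht => by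
    have hm := (blockOp_mem_linkingAlgebra hT).2
      ⟨zero_mem (leftAlg T), ht, zero_mem _, zero_mem _⟩
    have h1 := c1 _ hm fun e => by simp [blockOp_mul, blockOp_zero]
    have h2 := r2 _ hm fun e => by simp [blockOp_mul, blockOp_zero]
    rw [← blockOp_entries (F (blockOp 0 t 0 0)), h1.1, h1.2, h2.2, h₁₂ t ht]
  have f11 : ∀ a ∈ leftAlg T, F (blockOp a 0 0 0) = blockOp (Φ a) 0 0 0 := fun a ha => by
    have hm := (blockOp_mem_linkingAlgebra hT).2
      ⟨ha, zero_mem T, zero_mem _, zero_mem _⟩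
    have h1 := c2 _ hm fun e => by simp [blockOp_mul, blockOp_zero]
    have h2 := r2 _ hm fun e => by simp [blockOp_mul, blockOp_zero]
    have hF := hmem _ hm
    have hform := blockOp_entries (F (blockOp a 0 0 0))
    rw [h1.1, h1.2, h2.1] at hform
    rw [← hform] at hF ⊢
    refine blockOp_inj.2 ⟨hX.leftAlg_ext ((blockOp_mem_linkingAlgebra hX).1 hF).1
      (hΦ.mem a ha) fun y hy => ?_, rfl, rfl, rfl⟩
    have h3 := hr _ (m12 y hy) _ hm
    rw [← hform, blockOp_mul, blockOp_mul] at h3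
    simp only [ContinuousLinearMap.comp_zero, ContinuousLinearMap.zero_comp, add_zero] at h3
    rw [f12 _ (hT.leftAlg_comp ha (hp.le hy)), blockOp_inj] at h3
    rw [hΦ.comp a ha y hy]
    exact h3.2.1.symm
  have f22 : ∀ d ∈ leftAlg (adjointSpace T), F (blockOp 0 0 0 d) = blockOp 0 0 0 (Ψ d) :=
    fun d hd => by
    have hm := (blockOp_mem_linkingAlgebra hT).2
      ⟨zero_mem _, zero_mem T, zero_mem _, hd⟩
    have h1 := c1 _ hm fun e => by simp [blockOp_mul, blockOp_zero]
    have h2 := r1 _ hm fun e => by simp [blockOp_mul, blockOp_zero]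
    have hF := hmem _ hm
    have hform := blockOp_entries (F (blockOp 0 0 0 d))
    rw [h1.1, h1.2, h2.2] at hform
    rw [← hform] at hF ⊢
    refine blockOp_inj.2 ⟨rfl, rfl, rfl, ?_⟩
    have h4 := ((blockOp_mem_linkingAlgebra hX).1 hF).2.2.2
    refine (ContinuousLinearMap.adjoint (𝕜 := ℂ) (E := H) (F := H)).injective
      (hX.adjointSpace.leftAlg_ext (adjoint_mem_leftAlg h4)
        (adjoint_mem_leftAlg (hΨ.mem d hd)) fun y hy => ?_)
    have h3 := hl _ (m12 _ hy) _ hm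
    rw [← hform, blockOp_mul, blockOp_mul] at h3
    simp only [ContinuousLinearMap.comp_zero, ContinuousLinearMap.zero_comp, zero_add] at h3
    have hd' : d ∈ rightAlg T := by rwa [← leftAlg_adjointSpace]
    rw [f12 _ (hT.comp_rightAlg hd' (hp.le hy)), blockOp_inj,
      hΨ.apply_comp_of_adjointSpace hp hT hX hd hy] at h3
    have h5 := congrArg (ContinuousLinearMap.adjoint (𝕜 := ℂ) (E := H) (F := K)) h3.2.1
    rw [ContinuousLinearMap.adjoint_comp, ContinuousLinearMap.adjoint_comp,
      ContinuousLinearMap.adjoint_adjoint] at h5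
    exact h5.symm
  have f21 : ∀ s ∈ adjointSpace T, F (blockOp 0 0 s 0) = blockOp 0 0 (adjointMap p s) 0 :=
    fun s hs => by
    have hm := (blockOp_mem_linkingAlgebra hT).2
      ⟨zero_mem _, zero_mem T, hs, zero_mem _⟩
    have h1 := c2 _ hm fun e => by simp [blockOp_mul, blockOp_zero]
    have h2 := r1 _ hm fun e => by simp [blockOp_mul, blockOp_zero]
    have hF := hmem _ hm
    have hform := blockOp_entries (F (blockOp 0 0 s 0))
    rw [h1.1, h1.2, h2.1] at hform
    rw [← hform] at hF ⊢
    refine blockOp_inj.2 ⟨rfl, rfl, sub_eq_zero.1 ?_, rfl⟩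
    have h4 := sub_mem ((blockOp_mem_linkingAlgebra hX).1 hF).2.2.1
      (hp.adjointSpace.mem s hs)
    refine eq_zero_of_comp_adjoint_eq_zero ?_
    set σ := entry₂₁ (F (blockOp 0 0 s 0)) - adjointMap p s with hσ
    have h3 := hr _ (m12 _ h4) _ hm
    rw [← hform, blockOp_mul, blockOp_mul] at h3
    simp only [ContinuousLinearMap.comp_zero, ContinuousLinearMap.zero_comp, add_zero] at h3
    have h5 : s ∘L σ† ∈ leftAlg (adjointSpace T) :=
      comp_adjoint_mem_leftAlg hs (hp.adjointSpace.le h4)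
    rw [f22 _ h5, blockOp_inj, hΨ.apply_comp_adjoint hp.adjointSpace hT.adjointSpace
      hX.adjointSpace hs h4] at h3
    rw [hσ, ContinuousLinearMap.sub_comp, ← hσ, ← h3.2.2.2, sub_self]
  rw [← blockOp_entries m] at hm ⊢
  obtain ⟨k1, k2, k3, k4⟩ := (blockOp_mem_linkingAlgebra hT).1 hm
  have hsum : ∀ (a : K →L[ℂ] K) (b : H →L[ℂ] K) (c : K →L[ℂ] H) (d : H →L[ℂ] H),
      blockOp a b c d = blockOp a 0 0 0 + blockOp 0 b 0 0 + blockOp 0 0 c 0 + blockOp 0 0 0 d :=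
    fun a b c d => by
      rw [blockOp_add, blockOp_add, blockOp_add]
      simp only [add_zero, zero_add]
  rw [entrywiseMap_blockOp, hsum, map_add, map_add, map_add, f11 _ k1, f12 _ k2, f21 _ k3,
    f22 _ k4, ← hsum]

end Uniqueness

end

theorem theorem2p1 {H K : Type*}
    [NormedAddCommGroup H] [InnerProductSpace ℂ H] [CompleteSpace H]
    [NormedAddCommGroup K] [InnerProductSpace ℂ K] [CompleteSpace K]
    (T X : Submodule ℂ (H →L[ℂ] K)) (hT : IsTRO T) (hX : IsTRO X) (hXT : X ≤ T)
    (hnd : IsNondegenerateIn X T)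
    (P : T →ₗ[ℂ] X) (hP_contr : ∀ t : T, ‖P t‖ ≤ ‖t‖)
    (hP_idem : ∀ t : T, P (Submodule.inclusion hXT (P t)) = P t)
    (hP_onto : Function.Surjective P) :
    ∃ (PPd : leftAlg T →ₗ[ℂ] leftAlg X) (PdP : rightAlg T →ₗ[ℂ] rightAlg X)
      (E : linkingAlgebra T hT →ₗ[ℂ] linkingAlgebra X hX),
      IsConditionalExpectation (linkingAlgebra_mono hX hT hXT) E ∧
      (∀ (c : leftAlg T) (t s : T) (d : rightAlg T),
        E (linkingAlgebra.mk hT c t s d) =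
          linkingAlgebra.mk hX (PPd c) (P t) (P s) (PdP d)) ∧
      (∀ (n : ℕ) (a : Fin n → T) (x : Fin n → X),
        PPd (∑ i, ⟨(a i : H →L[ℂ] K) ∘L (x i : H →L[ℂ] K)†,
            comp_adjoint_mem_leftAlg (a i).2 (hXT (x i).2)⟩) =
          ∑ i, ⟨(P (a i) : H →L[ℂ] K) ∘L (x i : H →L[ℂ] K)†,
            comp_adjoint_mem_leftAlg (P (a i)).2 (x i).2⟩) ∧
      (∀ (n : ℕ) (a : Fin n → T) (x : Fin n → X),
        PdP (∑ i, ⟨(x i : H →L[ℂ] K)† ∘L (a i : H →L[ℂ] K),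
            adjoint_comp_mem_rightAlg (hXT (x i).2) (a i).2⟩) =
          ∑ i, ⟨(x i : H →L[ℂ] K)† ∘L (P (a i) : H →L[ℂ] K),
            adjoint_comp_mem_rightAlg (x i).2 (P (a i)).2⟩) ∧
      (∀ E' : linkingAlgebra T hT →ₗ[ℂ] linkingAlgebra X hX,
        IsConditionalExpectation (linkingAlgebra_mono hX hT hXT) E' →
        (∀ t : T, entry₁₂ (E' (linkingAlgebra.mk hT 0 t 0 0) :
            WithLp 2 (K × H) →L[ℂ] WithLp 2 (K × H)) = P t) →
        E' = E) := by
  obtain ⟨p, hpP⟩ := (X.subtype ∘ₗ P).exists_extend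
  have hpP' : ∀ t : T, p t = P t := fun t => congrArg (fun f : T →ₗ[ℂ] (H →L[ℂ] K) => f t) hpP
  have hp : IsContrProj T X p :=
    { le := hXT
      mem := fun t ht => by
        rw [hpP' ⟨t, ht⟩]
        exact (P ⟨t, ht⟩).2
      fix := fun x hx => by
        obtain ⟨t, ht⟩ := hP_onto ⟨x, hx⟩
        have h1 := hP_idem t
        rw [ht] at h1
        exact (hpP' ⟨x, hXT hx⟩).trans (congrArg Subtype.val h1)
      norm_le := fun t ht => by
        rw [hpP' ⟨t, ht⟩]
        exact hP_contr ⟨t, ht⟩ }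
  obtain ⟨Φ, hΦ⟩ := hp.exists_isCornerMap hT hX hnd.left.ge
  obtain ⟨Ψ, hΨ⟩ := hp.adjointSpace.exists_isCornerMap hT.adjointSpace hX.adjointSpace
    (adjointSpace_le_closedSpan hnd.right.ge)
  have D : IsExpectationData T X p Φ Ψ := ⟨hT, hX, hp, hΦ, hΨ⟩
  have hΨmem : ∀ d ∈ rightAlg T, Ψ d ∈ rightAlg X := fun d hd => by
    rw [← leftAlg_adjointSpace] at hd ⊢
    exact hΨ.mem d hd
  refine ⟨Φ.restrict hΦ.mem, Ψ.restrict hΨmem, restrictSubalgebra (entrywiseMap p Φ Ψ)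
    fun m hm => D.mem hm, isConditionalExpectation_restrictSubalgebra _ _
      (fun m hm => D.norm_le hm) (fun b hb => D.fix hb) (fun m hm h => D.isPositive hm h)
      (fun b hb m hm => D.map_mul_left hb hm) (fun b hb m hm => D.map_mul_right hb hm),
    ?_, ?_, ?_, ?_⟩
  · intro c t s d
    refine Subtype.ext ?_
    change entrywiseMap p Φ Ψ (blockOp _ _ _ _) = blockOp _ _ _ _
    rw [entrywiseMap_blockOp, adjointMap_apply, ContinuousLinearMap.adjoint_adjoint, hpP', hpP']
    rfl
  · intro n a x
    rw [map_sum]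
    refine Finset.sum_congr rfl fun i _ => Subtype.ext ?_
    have h1 := hΦ.apply_comp_adjoint hp hT hX (a i).2 (x i).2
    rw [hpP'] at h1
    exact h1
  · intro n a x
    rw [map_sum]
    refine Finset.sum_congr rfl fun i _ => Subtype.ext ?_
    have h1 := hΨ.apply_comp_adjoint_left hp.adjointSpace hT.adjointSpace hX.adjointSpace
      (adjoint_mem_adjointSpace (x i).2) (adjoint_mem_adjointSpace (a i).2)
    rw [adjointMap_apply, ContinuousLinearMap.adjoint_adjoint,
      ContinuousLinearMap.adjoint_adjoint, hpP'] at h1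
    exact h1
  · intro E' hE' h₁₂
    obtain ⟨F, hF, hFmem, hFl, hFr⟩ := hE'.exists_extension
    refine eq_restrictSubalgebra _ hF fun m hm =>
      D.eq_entrywiseMap F hFmem hFl hFr (fun t ht => ?_) hm
    have h1 := h₁₂ ⟨t, ht⟩
    rw [← hpP' ⟨t, ht⟩] at h1
    rw [← h1, ← hF _ (linkingAlgebra.mk hT 0 ⟨t, ht⟩ 0 0).2]
    refine congrArg (fun s => entry₁₂ (F (blockOp 0 t s 0))) ?_
    exact (map_zero (ContinuousLinearMap.adjoint (𝕜 := ℂ) (E := H) (F := K))).symm
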